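/- There is an absolute constant $C$ such that the following holds for all integers $n\ge 2$, $1\le s\le n$, $k\ge 1$, $b\ge 0$ and all real $0<\varepsilon\le 1$. Put $w=\lceil\log_2 n\rceil$. **Oracle access.** Let $A\in\mathbb C^{n\times n}$ be $s$-sparse (at most $s$ nonzero entries in each row and in each column) with $|A_{ij}|\le 1$ for all $i,j$. Oracle access to $A$ means access to three unitaries and their inverses: $O_r:|i\rangle|l\rangle\mapsto|i\rangle|r_{il}\rangle$ and $O_c:|j\rangle|l\rangle\mapsto|j\rangle|c_{jl}\rangle$ for $0\le i,j<n$, $0\le l<s$, where $r_{il}$ is the column index of the $l$-th nonzero entry (counted from $0$, in increasing order) of row $i$ and $c_{jl}$ is the row index of the $l$-th nonzero entry of column $j$, both replaced by $l+2^w$ if there is no such entry (first register of $w$ qubits, second of $w+1$ qubits); and $O_A:|i\rangle|j\rangle|0\rangle\mapsto|i\rangle|j\rangle|\tilde a_{ij}\rangle$ for $0\le i,j<n$, where $\tilde a_{ij}=\frac{p}{2^b}e^{2\pi \mathrm i q/2^b}$ is given by the integers $0\le p<2^{b+1}$, $0\le q<2^b$ in binary and equals $A_{ij}$, or at least satisfies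 $|\tilde a_{ij}-A_{ij}|\le\varepsilon/(2k)$. Nothing is assumed about the action of the oracles on other basis states. **Claim.** There is a quantum circuit on $w$ system qubits and some number of ancilla qubits, built from arbitrary one- and two-qubit gates and queries to the oracles and their inverses, which depends only on $n,s,k,b,\varepsilon$ (not on $A$ or the oracles), whose running time (number of gates plus number of queries) is at most $$C\,k\left(\log n+\log^{2.5}\!\left(\frac{sk}{\varepsilon}\right)\right),$$ and which, for every such $A$ and all such oracles, performs a unitary $U$ that is an $\varepsilon$-approximate block encoding of $(A/s)^k$: for every unit vector $|x_0\rangle\in\mathbb C^n$ (embedded in the $w$ system qubits), $$U|\mathbf 0\rangle|x_0\rangle=|\mathbf 0\rangle|y\rangle+\sum_{\mathbf j\ne\mathbf 0}|\mathbf j\rangle|\mathrm{Garbage}_{\mathbf j}\rangle,\qquad \left\|\,|y\rangle-\frac{A^k}{s^k}|x_0\rangle\right\|\le\varepsilon ,$$ with vectors $|\mathrm{Garbage}_{\mathbf j}\rangle$ that need not be normalized, $|\mathbf 0\rangle,|\mathbf j\rangle$ being computational basis states of the ancillas. -/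

import Mathlib

open scoped Matrix

noncomputable section

namespace SparseQuantum

/-! ### States and gates on wires -/

/-- The `m` low-order binary digits of `a` (digit `i` has weight `2 ^ i`), as a label of a
computational basis state of `m` qubits. -/
def bits (m a : ℕ) : Fin m → Bool := fun i => a.testBit i

/-- The computational basis state `|x⟩` of the qubits indexed by `ι`. -/
def ket {ι : Type} (x : ι → Bool) : (ι → Bool) → ℂ := by
  classical exact Pi.single x 1

/-- The operator `G`, which acts on the qubits indexed by `κ`, applied to the wires `e` of a larger
system of qubits indexed by `ι`, tensored with the identity on all the other wires. -/
def onWires {ι κ : Type} (e : κ ↪ ι) (G : Matrix (κ → Bool) (κ → Bool) ℂ) :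
    Matrix (ι → Bool) (ι → Bool) ℂ := by
  classical exact Matrix.of fun x y =>
    if ∀ i, i ∉ Set.range e → x i = y i then G (fun j => x (e j)) (fun j => y (e j)) else 0

/-! ### Circuits with access to three oracles -/

/-- Three black-box unitaries. `row` and `col` act on a `w`-qubit register and a `(w + 1)`-qubit
register; `entry` acts on two `w`-qubit registers and on an output register that consists of
`b + 1` qubits (a modulus) and `b` qubits (a phase). -/
structure Oracles (w b : ℕ) where
  row : Matrix.unitaryGroup (Fin w ⊕ Fin (w + 1) → Bool) ℂ
  col : Matrix.unitaryGroup (Fin w ⊕ Fin (w + 1) → Bool) ℂ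
  entry : Matrix.unitaryGroup ((Fin w ⊕ Fin w) ⊕ (Fin (b + 1) ⊕ Fin b) → Bool) ℂ

/-- One elementary step of a circuit on the wires `ι`: an arbitrary one-qubit gate, an arbitrary
two-qubit gate, or one query to one of the oracles (or to its inverse, if `inv` is `true`). -/
inductive Step (w b : ℕ) (ι : Type) : Type
  | gate1 (G : Matrix.unitaryGroup (Fin 1 → Bool) ℂ) (e : Fin 1 ↪ ι)
  | gate2 (G : Matrix.unitaryGroup (Fin 2 → Bool) ℂ) (e : Fin 2 ↪ ι)
  | row (inv : Bool) (e : Fin w ⊕ Fin (w + 1) ↪ ι)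
  | col (inv : Bool) (e : Fin w ⊕ Fin (w + 1) ↪ ι)
  | entry (inv : Bool) (e : (Fin w ⊕ Fin w) ⊕ (Fin (b + 1) ⊕ Fin b) ↪ ι)

/-- The operator that a step performs once the oracles are given. -/
def Step.eval {w b : ℕ} {ι : Type} (O : Oracles w b) :
    Step w b ι → Matrix (ι → Bool) (ι → Bool) ℂ
  | .gate1 G e => onWires e G.1
  | .gate2 G e => onWires e G.1
  | .row inv e => onWires e (if inv then O.row⁻¹ else O.row).1
  | .col inv e => onWires e (if inv then O.col⁻¹ else O.col).1
  | .entry inv e => onWires e (if inv then O.entry⁻¹ else O.entry).1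

/-- An oracle circuit: a list of steps, the head of the list being performed first. The description
of the circuit does not involve the oracles. -/
abbrev Circuit (w b : ℕ) (ι : Type) : Type := List (Step w b ι)

/-- The running time: the number of one- and two-qubit gates plus the number of queries. -/
def Circuit.time {w b : ℕ} {ι : Type} (c : Circuit w b ι) : ℕ := List.length c

/-- The operator that a circuit performs once the oracles are given. -/
def Circuit.eval {w b : ℕ} {ι : Type} [Fintype ι] [DecidableEq ι] (O : Oracles w b) :
    Circuit w b ι → Matrix (ι → Bool) (ι → Bool) ℂ
  | [] => 1
  | g :: c => Circuit.eval O c * g.eval O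

/-! ### Sparse access to a matrix -/

/-- The number of qubits that hold an index `i < n`, namely `⌈log₂ n⌉`. -/
def numQubits (n : ℕ) : ℕ := Nat.clog 2 n

open Classical in
/-- The number of nonzero entries in row `i`. -/
def rowCount {n : ℕ} (A : Matrix (Fin n) (Fin n) ℂ) (i : Fin n) : ℕ :=
  (Finset.univ.filter fun j => A i j ≠ 0).card

/-- At most `s` nonzero entries in every row and in every column. -/
def IsSparse {n : ℕ} (A : Matrix (Fin n) (Fin n) ℂ) (s : ℕ) : Prop :=
  (∀ i, rowCount A i ≤ s) ∧ ∀ j, rowCount Aᵀ j ≤ s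

/-- The column index of the `l`-th nonzero entry (counting from `0`, in increasing order) of row
`i`; it is `l + 2 ^ ⌈log₂ n⌉`, which is not an index, if the row has no `l`-th nonzero entry. -/
def location {n : ℕ} (A : Matrix (Fin n) (Fin n) ℂ) (i : Fin n) (l : ℕ) : ℕ :=
  if l < rowCount A i then Nat.nth (fun j => ∃ h : j < n, A i ⟨j, h⟩ ≠ 0) l
  else l + 2 ^ numQubits n

/-- The location oracle `|i⟩|l⟩ ↦ |i⟩|location A i l⟩` for `i < n` and `l < s`; its action on other
states is not specified. -/
def IsLocationOracle {n : ℕ} (A : Matrix (Fin n) (Fin n) ℂ) (s : ℕ)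
    (U : Matrix.unitaryGroup (Fin (numQubits n) ⊕ Fin (numQubits n + 1) → Bool) ℂ) : Prop :=
  ∀ (i : Fin n) (l : ℕ), l < s →
    U.1 *ᵥ ket (Sum.elim (bits (numQubits n) i) (bits (numQubits n + 1) l)) =
      ket (Sum.elim (bits (numQubits n) i) (bits (numQubits n + 1) (location A i l)))

/-- The complex number described by a modulus with `b` fractional bits and a phase, in units of a
full turn, with `b` fractional bits. -/
def value {b : ℕ} (c : Fin (b + 1) ⊕ Fin b → Bool) : ℂ :=
  ((Nat.ofBits fun i => c (Sum.inl i) : ℕ) / 2 ^ b : ℂ) *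
    Complex.exp (2 * Real.pi * Complex.I * ((Nat.ofBits fun i => c (Sum.inr i) : ℕ) / 2 ^ b))

/-- The entry oracle `|i⟩|j⟩|0⟩ ↦ |i⟩|j⟩|c i j⟩` for `i, j < n`, where `c i j` is a binary description
of `A i j` up to the error `τ` (so `τ = 0` means that the entries are given exactly). -/
def IsEntryOracle {n b : ℕ} (A : Matrix (Fin n) (Fin n) ℂ) (τ : ℝ)
    (U : Matrix.unitaryGroup
      ((Fin (numQubits n) ⊕ Fin (numQubits n)) ⊕ (Fin (b + 1) ⊕ Fin b) → Bool) ℂ) : Prop :=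
  ∀ i j : Fin n, ∃ c : Fin (b + 1) ⊕ Fin b → Bool, ‖value c - A i j‖ ≤ τ ∧
    U.1 *ᵥ ket (Sum.elim (Sum.elim (bits (numQubits n) i) (bits (numQubits n) j))
        (fun _ => false)) =
      ket (Sum.elim (Sum.elim (bits (numQubits n) i) (bits (numQubits n) j)) c)

/-- Oracle access to the `s`-sparse matrix `A`: locations in rows, locations in columns, entries. -/
structure IsSparseAccess {n b : ℕ} (A : Matrix (Fin n) (Fin n) ℂ) (s : ℕ) (τ : ℝ)
    (O : Oracles (numQubits n) b) : Prop where
  row : IsLocationOracle A s O.row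
  col : IsLocationOracle Aᵀ s O.col
  entry : IsEntryOracle A τ O.entry

/-! ### Block encodings -/

/-- The state `∑ i, x i |i⟩` of `⌈log₂ n⌉` qubits. -/
def amplitudes {n : ℕ} (x : EuclideanSpace ℂ (Fin n)) :
    EuclideanSpace ℂ (Fin (numQubits n) → Bool) :=
  WithLp.toLp 2 (∑ i : Fin n, x i • ket (bits (numQubits n) i))

/-- The product state `|α⟩|ψ⟩` of the ancilla qubits `Fin a` and the system qubits `Fin w`. -/
def tensor {w a : ℕ} (α : (Fin a → Bool) → ℂ) (ψ : (Fin w → Bool) → ℂ) :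
    (Fin w ⊕ Fin a → Bool) → ℂ :=
  fun x => α (fun i => x (Sum.inr i)) * ψ (fun i => x (Sum.inl i))

/-- `U |0⟩|x⟩ = |0⟩ B|x⟩ + ∑_{j ≠ 0} |j⟩|garbage j⟩` for every unit vector `x` of `ℂⁿ`, up to the
additive error `ε` in the component `B|x⟩`. By linearity of `U` this says that the `|0⟩⟨0|`-block of
`U` differs from `B` by at most `ε` in operator norm, on the span of the `|i⟩` with `i < n`: `U` is
an `ε`-approximate block encoding of `B`. -/
def IsApproxBlockEncoding {n a : ℕ}
    (U : Matrix (Fin (numQubits n) ⊕ Fin a → Bool) (Fin (numQubits n) ⊕ Fin a → Bool) ℂ)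
    (B : Matrix (Fin n) (Fin n) ℂ) (ε : ℝ) : Prop :=
  ∀ x : EuclideanSpace ℂ (Fin n), ‖x‖ = 1 →
    ∃ (y : EuclideanSpace ℂ (Fin (numQubits n) → Bool))
      (garbage : (Fin a → Bool) → (Fin (numQubits n) → Bool) → ℂ),
      ‖y - amplitudes (WithLp.toLp 2 (B *ᵥ x.ofLp))‖ ≤ ε ∧
      U *ᵥ tensor (ket fun _ => false) (amplitudes x).ofLp =
        tensor (ket fun _ => false) y.ofLp +
          ∑ j ∈ Finset.univ.filter (fun j : Fin a → Bool => j ≠ fun _ => false),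
            tensor (ket j) (garbage j)

end SparseQuantum

end

/-!
The circuit consists of `k` copies of an exact block encoding of a contraction close to `A / s`,
with fresh ancillas for each copy, so that the blocks multiply (`block_mul`) and the errors of the
`k` factors at most add up (`norm_pow_mulVec_sub_le`). The bookkeeping is done by the predicate
`Encodes t B`: the operators `B O` are the `|0⟩⟨0|`-blocks of one oracle circuit with at most `t`
steps, whatever the oracles `O` are. The operators with this property are closed under products,
adjoints, placement on more wires and passing to blocks, and all later statements are about
matrices only.

One factor (`exists_encodes_step`) starts from `|j⟩` and a uniform superposition of the `|l⟩` with
`l < s`. The column oracle turns `|j⟩|l⟩` into `|j⟩|i⟩`, where `i` is the row of the `l`-th nonzero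
entry of column `j`; the two registers are swapped; the entry oracle writes a description of
`A i j`, which is used to multiply the amplitude by an approximation of `A i j` and is then erased by
a second query; the inverse of the row oracle turns `|i⟩|j⟩` into `|i⟩|l'⟩`, and the preparation of
the superposition is undone. Missing entries are marked by the top qubit of the answer of the
column oracle, which is not touched again and therefore only contributes to the garbage.

Two constructions keep the running time of one factor small, in fact of the order of
`log n + log (k / ε)`.

* The uniform superposition over `[0, s)` takes about `log₂ n` two-qubit gates and no approximation
  (`exists_encodes_uniform`): the uniform superpositions over `[0, r)` and over `[r, 2 ^ m)` are
  orthogonal, and removing the top digit expresses both of them through the corresponding two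
  states for `m - 1` digits.
* The multiplication by an entry needs no arithmetic (`encodes_approxValue`). The phase is a
  product of one-qubit phases, one for each binary digit. The modulus `x = ∑ dᵢ / 2 ^ i` is the
  average of `1` and of `∑ ± 1 / 2 ^ i - 1 / 2 ^ m`, where the sign is given by the digit `dᵢ`, and
  averages of controlled diagonal operators are obtained by splitting the excitation of the control
  qubit (`Encodes.controlled_average`). A modulus of at least `1` (more than `1`
  only through a rounding error of the oracle) is replaced by `1` with one more control
  (`Encodes.clip`); this is the projection to the unit disc, and so it does not increase the distance to `A i j`.

Taking `m` digits with `2 ^ m ≥ 16 k / ε` gives entries with an error of at most `ε / k`, and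
Schur's test (`norm_mulVec_le_of_isSparse`) turns this into an error of at most `ε / k` in operator
norm for each of the `k` factors.
-/

open scoped Matrix

noncomputable section

namespace SparseQuantum

/-! ### Operators on wires -/

section Wires

variable {ι κ μ : Type}

theorem ket_self (x : ι → Bool) : ket x x = 1 := by
  classical exact Pi.single_eq_same _ _

theorem ket_of_ne {x y : ι → Bool} (h : y ≠ x) : ket x y = 0 := by
  classical exact Pi.single_eq_of_ne h _

theorem ket_apply [DecidableEq (ι → Bool)] (x y : ι → Bool) :
    ket x y = if y = x then 1 else 0 := by
  split_ifs with h
  · rw [h, ket_self]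
  · exact ket_of_ne h

theorem onWires_apply (e : κ ↪ ι) (G : Matrix (κ → Bool) (κ → Bool) ℂ) (x y : ι → Bool)
    [Decidable (∀ i, i ∉ Set.range e → x i = y i)] :
    onWires e G x y =
      if ∀ i, i ∉ Set.range e → x i = y i then G (x ∘ e) (y ∘ e) else 0 := by
  unfold onWires
  rw [Matrix.of_apply]
  congr

theorem onWires_conjTranspose (e : κ ↪ ι) (G : Matrix (κ → Bool) (κ → Bool) ℂ) :
    onWires e Gᴴ = (onWires e G)ᴴ := by
  classical
  ext x y
  rw [Matrix.conjTranspose_apply, onWires_apply, onWires_apply]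
  simp only [eq_comm (a := x _)]
  split_ifs <;> simp

theorem onWires_trans (e : κ ↪ ι) (f : ι ↪ μ) (G : Matrix (κ → Bool) (κ → Bool) ℂ) :
    onWires (e.trans f) G = onWires f (onWires e G) := by
  classical
  ext x y
  rw [onWires_apply, onWires_apply, onWires_apply, ← ite_and]
  refine if_congr ⟨fun h => ⟨fun i hi => h i ?_, fun i hi => h (f i) ?_⟩, fun h i hi => ?_⟩ rfl rfl
  · rintro ⟨j, rfl⟩
    exact hi ⟨e j, rfl⟩
  · rintro ⟨j, hj⟩
    exact hi ⟨j, f.injective hj⟩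
  · by_cases hf : i ∈ Set.range f
    · obtain ⟨j, rfl⟩ := hf
      refine h.2 j ?_
      rintro ⟨a, rfl⟩
      exact hi ⟨a, rfl⟩
    · exact h.1 i hf

theorem onWires_diagonal [DecidableEq (κ → Bool)] [DecidableEq (ι → Bool)] (e : κ ↪ ι)
    (d : (κ → Bool) → ℂ) :
    onWires e (Matrix.diagonal d) = Matrix.diagonal fun x => d (x ∘ e) := by
  classical
  ext x y
  rw [onWires_apply, Matrix.diagonal_apply, Matrix.diagonal_apply, ← ite_and]
  refine if_congr ⟨fun h => funext fun i => ?_, ?_⟩ rfl rfl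
  · by_cases hi : i ∈ Set.range e
    · obtain ⟨j, rfl⟩ := hi
      exact congrFun h.2 j
    · exact h.1 i hi
  · rintro rfl
    exact ⟨fun _ _ => rfl, rfl⟩

theorem extend_comp_embedding (e : κ ↪ ι) (x : ι → Bool) (y : κ → Bool) :
    Function.extend e y x ∘ e = y :=
  funext fun j => e.injective.extend_apply y x j

theorem extend_self (e : κ ↪ ι) (x : ι → Bool) : Function.extend e (x ∘ e) x = x := by
  ext i
  by_cases hi : ∃ j, e j = i
  · obtain ⟨j, rfl⟩ := hi
    rw [e.injective.extend_apply]; rfl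
  · rw [Function.extend_apply' _ _ _ hi]

theorem extend_extend (e : κ ↪ ι) (x : ι → Bool) (y z : κ → Bool) :
    Function.extend e z (Function.extend e y x) = Function.extend e z x := by
  ext i
  by_cases hi : ∃ j, e j = i
  · obtain ⟨j, rfl⟩ := hi
    rw [e.injective.extend_apply, e.injective.extend_apply]
  · rw [Function.extend_apply' _ _ _ hi, Function.extend_apply' _ _ _ hi,
      Function.extend_apply' _ _ _ hi]

section

variable [Fintype ι] [DecidableEq ι]

/-- An operator does not change the values of the wires on which it does not act, so it preserves
the states without a component at which such a wire `t` has the value `v`. -/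
theorem onWires_mulVec_eq_zero {e : κ ↪ ι} (G : Matrix (κ → Bool) (κ → Bool) ℂ) {t : ι}
    (ht : t ∉ Set.range e) {v : Bool} {ψ : (ι → Bool) → ℂ} (hψ : ∀ z, z t = v → ψ z = 0)
    (z : ι → Bool) (hz : z t = v) : (onWires e G *ᵥ ψ) z = 0 := by
  classical
  refine Finset.sum_eq_zero fun y _ => ?_
  dsimp only
  rw [onWires_apply]
  split_ifs with h
  · rw [hψ y (by rw [← h t ht, hz]), mul_zero]
  · rw [zero_mul]

end

variable [Fintype κ] [DecidableEq κ]

/-- The state `v` of the wires `e`, all other wires being in the basis state that `x` gives. -/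
def lift (e : κ ↪ ι) (x : ι → Bool) : ((κ → Bool) → ℂ) →ₗ[ℂ] ((ι → Bool) → ℂ) :=
  Fintype.linearCombination ℂ fun y => ket (Function.extend e y x)

theorem lift_ket (e : κ ↪ ι) (x : ι → Bool) (y : κ → Bool) :
    lift e x (ket y) = ket (Function.extend e y x) := by
  simp [lift, Fintype.linearCombination_apply, ket_apply]

variable [Fintype ι] [DecidableEq ι]

theorem mulVec_ket_apply (M : Matrix (ι → Bool) (ι → Bool) ℂ) (x y : ι → Bool) :
    (M *ᵥ ket x) y = M y x := by
  simp [Matrix.mulVec, dotProduct, ket_apply]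

theorem matrix_ext_ket {M N : Matrix (ι → Bool) (ι → Bool) ℂ}
    (h : ∀ x, M *ᵥ ket x = N *ᵥ ket x) : M = N := by
  ext y x
  rw [← mulVec_ket_apply M, h, mulVec_ket_apply]

theorem diagonal_mulVec_ket (d : (ι → Bool) → ℂ) (x : ι → Bool) :
    Matrix.diagonal d *ᵥ ket x = d x • ket x := by
  ext y
  rw [mulVec_ket_apply, Matrix.diagonal_apply, Pi.smul_apply, ket_apply]
  by_cases h : y = x <;> simp [h]

theorem onWires_mulVec_ket (e : κ ↪ ι) (G : Matrix (κ → Bool) (κ → Bool) ℂ) (x : ι → Bool) :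
    onWires e G *ᵥ ket x = lift e x (G *ᵥ ket (x ∘ e)) := by
  ext z
  rw [mulVec_ket_apply, lift, Fintype.linearCombination_apply, Finset.sum_apply]
  simp only [Pi.smul_apply, mulVec_ket_apply, smul_eq_mul, ket_apply]
  classical
  rw [onWires_apply]
  by_cases h : ∀ i, i ∉ Set.range e → z i = x i
  · rw [if_pos h, Finset.sum_eq_single (z ∘ e)]
    · rw [if_pos, mul_one]
      ext i
      by_cases hi : ∃ j, e j = i
      · obtain ⟨j, rfl⟩ := hi
        rw [e.injective.extend_apply]; rfl
      · rw [Function.extend_apply' _ _ _ hi]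
        exact h i hi
    · intro y _ hy
      rw [if_neg, mul_zero]
      rintro rfl
      exact hy (extend_comp_embedding e x y).symm
    · simp
  · rw [if_neg h]
    refine (Finset.sum_eq_zero fun y _ => ?_).symm
    rw [if_neg, mul_zero]
    rintro rfl
    exact h fun i hi => Function.extend_apply' _ _ _ hi

theorem pi_eq_sum_ket (v : (ι → Bool) → ℂ) : v = ∑ y, v y • ket y := by
  ext z
  simp [ket_apply]

theorem onWires_mulVec_lift (e : κ ↪ ι) (G : Matrix (κ → Bool) (κ → Bool) ℂ) (x : ι → Bool)
    (v : (κ → Bool) → ℂ) : onWires e G *ᵥ lift e x v = lift e x (G *ᵥ v) := by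
  rw [pi_eq_sum_ket v, map_sum, Matrix.mulVec_sum, Matrix.mulVec_sum, map_sum]
  refine Finset.sum_congr rfl fun y _ => ?_
  rw [map_smul, Matrix.mulVec_smul, Matrix.mulVec_smul, map_smul, lift_ket, onWires_mulVec_ket,
    extend_comp_embedding]
  simp only [lift, extend_extend]

theorem onWires_mulVec_ket_of_eq_ket {e : κ ↪ ι} {G : Matrix (κ → Bool) (κ → Bool) ℂ}
    {x : ι → Bool} {y : κ → Bool} {z : ι → Bool} (h : G *ᵥ ket (x ∘ e) = ket y)
    (hz : Function.extend e y x = z) : onWires e G *ᵥ ket x = ket z := by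
  rw [onWires_mulVec_ket, h, lift_ket, hz]

theorem onWires_mul (e : κ ↪ ι) (G H : Matrix (κ → Bool) (κ → Bool) ℂ) :
    onWires e (G * H) = onWires e G * onWires e H := by
  refine matrix_ext_ket fun x => ?_
  rw [← Matrix.mulVec_mulVec, onWires_mulVec_ket, onWires_mulVec_ket, onWires_mulVec_lift,
    Matrix.mulVec_mulVec]

theorem onWires_one (e : κ ↪ ι) : onWires e (1 : Matrix (κ → Bool) (κ → Bool) ℂ) = 1 := by
  refine matrix_ext_ket fun x => ?_
  rw [onWires_mulVec_ket, Matrix.one_mulVec, Matrix.one_mulVec, lift_ket, extend_self]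

end Wires

/-! ### Circuits -/

section Circuits

variable {w b : ℕ} {ι κ : Type}

/-- A step moved to other wires. -/
def Step.map (f : κ ↪ ι) : Step w b κ → Step w b ι
  | .gate1 G e => .gate1 G (e.trans f)
  | .gate2 G e => .gate2 G (e.trans f)
  | .row inv e => .row inv (e.trans f)
  | .col inv e => .col inv (e.trans f)
  | .entry inv e => .entry inv (e.trans f)

theorem Step.eval_map (f : κ ↪ ι) (g : Step w b κ) (O : Oracles w b) :
    (g.map f).eval O = onWires f (g.eval O) := by
  cases g <;> exact onWires_trans _ _ _

/-- The inverse of a step. -/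
def Step.inverse : Step w b ι → Step w b ι
  | .gate1 G e => .gate1 G⁻¹ e
  | .gate2 G e => .gate2 G⁻¹ e
  | .row inv e => .row (!inv) e
  | .col inv e => .col (!inv) e
  | .entry inv e => .entry (!inv) e

theorem Step.eval_inverse (g : Step w b ι) (O : Oracles w b) :
    g.inverse.eval O = (g.eval O)ᴴ := by
  cases g with
  | gate1 G e => exact onWires_conjTranspose _ _
  | gate2 G e => exact onWires_conjTranspose _ _
  | row inv e =>
    cases inv
    · exact onWires_conjTranspose _ _
    · rw [← Matrix.conjTranspose_conjTranspose (Step.eval O (Step.inverse _)), eq_comm]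
      exact congrArg _ (onWires_conjTranspose _ _)
  | col inv e =>
    cases inv
    · exact onWires_conjTranspose _ _
    · rw [← Matrix.conjTranspose_conjTranspose (Step.eval O (Step.inverse _)), eq_comm]
      exact congrArg _ (onWires_conjTranspose _ _)
  | entry inv e =>
    cases inv
    · exact onWires_conjTranspose _ _
    · rw [← Matrix.conjTranspose_conjTranspose (Step.eval O (Step.inverse _)), eq_comm]
      exact congrArg _ (onWires_conjTranspose _ _)

variable [Fintype ι] [DecidableEq ι]

theorem Circuit.eval_append (O : Oracles w b) (c d : Circuit w b ι) :
    Circuit.eval O (c ++ d) = Circuit.eval O d * Circuit.eval O c := by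
  induction c with
  | nil => simp [Circuit.eval]
  | cons g c ih => rw [List.cons_append, Circuit.eval, ih, Circuit.eval, mul_assoc]

theorem Circuit.eval_map [Fintype κ] [DecidableEq κ] (f : κ ↪ ι) (c : Circuit w b κ)
    (O : Oracles w b) :
    Circuit.eval O (List.map (Step.map f) c) = onWires f (Circuit.eval O c) := by
  induction c with
  | nil => exact (onWires_one f).symm
  | cons g c ih => rw [List.map_cons, Circuit.eval, ih, Step.eval_map, Circuit.eval, onWires_mul]

theorem Circuit.eval_inverse (c : Circuit w b ι) (O : Oracles w b) :
    Circuit.eval O (List.map Step.inverse c).reverse = (Circuit.eval O c)ᴴ := by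
  induction c with
  | nil => exact Matrix.conjTranspose_one.symm
  | cons g c ih =>
    rw [List.map_cons, List.reverse_cons, Circuit.eval_append, ih, Circuit.eval,
      Circuit.eval, one_mul, Step.eval_inverse, ← Matrix.conjTranspose_mul]
    rfl

end Circuits

/-! ### Exact block encodings -/

section Encodes

variable {w b : ℕ} {ι κ ρ σ : Type}

/-- The block of an operator in which the wires `ρ` are in the state `|0⟩` before and after. -/
def block (M : Matrix (κ ⊕ ρ → Bool) (κ ⊕ ρ → Bool) ℂ) : Matrix (κ → Bool) (κ → Bool) ℂ :=
  Matrix.of fun x y => M (Sum.elim x fun _ => false) (Sum.elim y fun _ => false)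

/-- The operators `B O` on the wires `κ` are the `|0⟩⟨0|`-blocks of an oracle circuit of running
time at most `t`, with any finite set `ρ` of ancilla wires. -/
def Encodes [Fintype κ] [DecidableEq κ] (t : ℕ)
    (B : Oracles w b → Matrix (κ → Bool) (κ → Bool) ℂ) : Prop :=
  ∃ (ρ : Type) (_ : Fintype ρ) (_ : DecidableEq ρ) (c : Circuit w b (κ ⊕ ρ)),
    c.time ≤ t ∧ ∀ O, block (c.eval O) = B O

/-- The embedding `e` on the main wires and `f` on the ancilla wires. -/
def sumEmb (e : κ ↪ ι) (f : ρ ↪ σ) : κ ⊕ ρ ↪ ι ⊕ σ := e.sumMap f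

theorem block_onWires_sumEmb (e : κ ↪ ι) (f : ρ ↪ σ)
    (M : Matrix (κ ⊕ ρ → Bool) (κ ⊕ ρ → Bool) ℂ) :
    block (onWires (sumEmb e f) M) = onWires e (block M) := by
  classical
  ext x y
  rw [block, Matrix.of_apply, onWires_apply, onWires_apply]
  refine if_congr ⟨fun h i hi => ?_, fun h i hi => ?_⟩ ?_ rfl
  · refine h (Sum.inl i) ?_
    rintro ⟨j | j, hj⟩
    · exact hi ⟨j, Sum.inl.inj hj⟩
    · cases hj
  · rcases i with i | i
    · refine h i ?_
      rintro ⟨j, rfl⟩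
      exact hi ⟨Sum.inl j, rfl⟩
    · rfl
  · rw [block, Matrix.of_apply]
    congr 1 <;> ext (i | i) <;> rfl

variable [Fintype ι] [DecidableEq ι] [Fintype κ] [DecidableEq κ]
  [Fintype ρ] [DecidableEq ρ] [Fintype σ] [DecidableEq σ]

theorem sum_elim_false_right (f : (κ ⊕ ρ → Bool) → ℂ)
    (hf : ∀ z, f z ≠ 0 → ∀ r, z (Sum.inr r) = false) :
    ∑ z, f z = ∑ x : κ → Bool, f (Sum.elim x fun _ => false) := by
  classical
  symm
  refine Finset.sum_of_injOn (fun x => Sum.elim x fun _ => false) ?_ ?_ ?_ ?_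
  · intro x _ y _ h
    ext i
    exact congrFun h (Sum.inl i)
  · simp
  · intro z _ hz
    by_contra h
    refine hz ⟨fun i => z (Sum.inl i), by simp, ?_⟩
    ext (i | i)
    · rfl
    · exact (hf z h i).symm
  · simp

/-- Blocks multiply if the two operators use disjoint sets of ancilla wires. -/
theorem block_mul (M : Matrix (κ ⊕ ρ → Bool) (κ ⊕ ρ → Bool) ℂ)
    (N : Matrix (κ ⊕ σ → Bool) (κ ⊕ σ → Bool) ℂ) :
    block (onWires (sumEmb (.refl κ) (.inl (β := σ))) M *
      onWires (sumEmb (.refl κ) (.inr (α := ρ))) N) = block M * block N := by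
  classical
  ext x y
  rw [block, Matrix.of_apply, Matrix.mul_apply, sum_elim_false_right]
  · have h1 := block_onWires_sumEmb (.refl κ) (.inl (α := ρ) (β := σ)) M
    have h2 := block_onWires_sumEmb (.refl κ) (.inr (α := ρ) (β := σ)) N
    have h3 : ∀ B : Matrix (κ → Bool) (κ → Bool) ℂ, onWires (.refl κ) B = B := by
      intro B
      ext u v
      rw [onWires_apply, if_pos fun i hi => (hi ⟨i, rfl⟩).elim]
      rfl
    rw [h3] at h1 h2
    rw [Matrix.mul_apply, ← h1, ← h2]
    rfl
  · rintro z hz (r | r)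
    · have := right_ne_zero_of_mul hz
      rw [onWires_apply] at this
      exact (ite_ne_right_iff.1 this).1 (Sum.inr (Sum.inl r)) (by
        rintro ⟨j | j, hj⟩
        · cases hj
        · cases Sum.inr.inj hj)
    · have := left_ne_zero_of_mul hz
      rw [onWires_apply] at this
      exact ((ite_ne_right_iff.1 this).1 (Sum.inr (Sum.inr r)) (by
        rintro ⟨j | j, hj⟩
        · cases hj
        · cases Sum.inr.inj hj)).symm

namespace Encodes

variable {t t' : ℕ} {B B' : Oracles w b → Matrix (κ → Bool) (κ → Bool) ℂ}

theorem mono (h : Encodes t B) (htt : t ≤ t') : Encodes t' B := by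
  obtain ⟨ρ, i, j, c, hc, hB⟩ := h
  exact ⟨ρ, i, j, c, hc.trans htt, hB⟩

theorem congr (h : Encodes t B) (hB : ∀ O, B O = B' O) : Encodes t B' :=
  (funext hB : B = B') ▸ h

theorem of_circuit (c : Circuit w b κ) : Encodes c.time fun O => c.eval O := by
  refine ⟨Empty, inferInstance, inferInstance,
    List.map (Step.map Function.Embedding.inl) c, (List.length_map _).le, fun O => ?_⟩
  ext x y
  rw [Circuit.eval_map, block, Matrix.of_apply]
  classical
  rw [onWires_apply, if_pos]
  · rfl
  · rintro (i | i) hi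
    · exact (hi ⟨i, rfl⟩).elim
    · exact i.elim

theorem of_step (g : Step w b κ) : Encodes 1 fun O => g.eval O :=
  (of_circuit [g]).congr fun O => by rw [Circuit.eval, Circuit.eval, one_mul]

theorem one : Encodes 0 fun _ : Oracles w b => (1 : Matrix (κ → Bool) (κ → Bool) ℂ) :=
  of_circuit []

theorem mul (h : Encodes t B) (h' : Encodes t' B') : Encodes (t + t') fun O => B O * B' O := by
  obtain ⟨ρ, _, _, c, hc, hB⟩ := h
  obtain ⟨ρ', _, _, c', hc', hB'⟩ := h'
  refine ⟨ρ ⊕ ρ', inferInstance, inferInstance,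
    List.map (Step.map (sumEmb (.refl κ) .inr)) c' ++ List.map (Step.map (sumEmb (.refl κ) .inl)) c,
    ?_, fun O => ?_⟩
  · unfold Circuit.time at *
    rw [List.length_append, List.length_map, List.length_map]
    omega
  · rw [Circuit.eval_append, Circuit.eval_map, Circuit.eval_map, block_mul, hB, hB']

theorem pow (h : Encodes t B) (k : ℕ) : Encodes (k * t) fun O => B O ^ k := by
  induction k with
  | zero => exact (one.mono (Nat.zero_le _)).congr fun O => (pow_zero _).symm
  | succ k ih => exact ((ih.mul h).mono (by rw [Nat.succ_mul])).congr fun O => (pow_succ _ _).symm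

theorem conjTranspose (h : Encodes t B) : Encodes t fun O => (B O)ᴴ := by
  obtain ⟨ρ, _, _, c, hc, hB⟩ := h
  refine ⟨ρ, inferInstance, inferInstance, (List.map Step.inverse c).reverse, ?_, fun O => ?_⟩
  · unfold Circuit.time at *
    rwa [List.length_reverse, List.length_map]
  · simp only [Circuit.eval_inverse, ← hB]
    rfl

theorem onWires (h : Encodes t B) (e : κ ↪ ι) : Encodes t fun O => onWires e (B O) := by
  obtain ⟨ρ, _, _, c, hc, hB⟩ := h
  refine ⟨ρ, inferInstance, inferInstance, List.map (Step.map (sumEmb e (.refl ρ))) c, ?_,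
    fun O => ?_⟩
  · unfold Circuit.time at *
    rwa [List.length_map]
  · rw [Circuit.eval_map, block_onWires_sumEmb, hB]

theorem block {B : Oracles w b → Matrix (κ ⊕ ρ → Bool) (κ ⊕ ρ → Bool) ℂ} (h : Encodes t B) :
    Encodes t fun O => block (B O) := by
  obtain ⟨σ, _, _, c, hc, hB⟩ := h
  refine ⟨ρ ⊕ σ, inferInstance, inferInstance,
    List.map (Step.map (Equiv.sumAssoc κ ρ σ).toEmbedding) c, ?_, fun O => ?_⟩
  · unfold Circuit.time at *
    rwa [List.length_map]
  · simp only [Circuit.eval_map, ← hB]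
    classical
    ext x y
    rw [SparseQuantum.block, Matrix.of_apply, onWires_apply, if_pos]
    · rw [SparseQuantum.block, SparseQuantum.block, Matrix.of_apply, Matrix.of_apply]
      congr 1 <;> ext ((i | i) | i) <;> rfl
    · intro i hi
      exact (hi ((Equiv.sumAssoc κ ρ σ).surjective i)).elim

/-- The ancilla wires can be numbered. -/
theorem exists_fin (h : Encodes t B) : ∃ (a : ℕ) (c : Circuit w b (κ ⊕ Fin a)),
    c.time ≤ t ∧ ∀ O, SparseQuantum.block (c.eval O) = B O := by
  obtain ⟨ρ, _, _, c, hc, hB⟩ := h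
  refine ⟨Fintype.card ρ,
    List.map (Step.map (sumEmb (.refl κ) (Fintype.equivFin ρ).toEmbedding)) c, ?_, fun O => ?_⟩
  · unfold Circuit.time at *
    rwa [List.length_map]
  · rw [Circuit.eval_map, block_onWires_sumEmb, hB]
    classical
    ext u v
    rw [onWires_apply, if_pos fun i hi => (hi ⟨i, rfl⟩).elim]
    rfl

end Encodes

end Encodes

/-! ### One- and two-qubit gates -/

section Gates

variable {w b : ℕ} {ι : Type}

/-- Orthonormal vectors can be prescribed as the images of some of the basis states. -/
theorem exists_unitary_mulVec_ket {κ : Type} [Fintype κ] [DecidableEq κ] (S : Set (κ → Bool))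
    (v : (κ → Bool) → (κ → Bool) → ℂ)
    (hv : ∀ x ∈ S, ∀ y ∈ S, star (v x) ⬝ᵥ v y = if x = y then 1 else 0) :
    ∃ G : Matrix.unitaryGroup (κ → Bool) ℂ, ∀ x ∈ S, G.1 *ᵥ ket x = v x := by
  have ho : Orthonormal ℂ (S.domRestrict fun x => (WithLp.toLp 2 (v x) :
      EuclideanSpace ℂ (κ → Bool))) := by
    rw [orthonormal_iff_ite]
    rintro ⟨x, hx⟩ ⟨y, hy⟩
    rw [Set.domRestrict_apply, Set.domRestrict_apply, EuclideanSpace.inner_toLp_toLp,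
      dotProduct_comm, hv x hx y hy]
    simp only [Subtype.mk.injEq]
  obtain ⟨u, hu⟩ := ho.exists_orthonormalBasis_extension_of_card_eq (by simp)
  refine ⟨⟨Matrix.of fun y x => u x y, ?_⟩, fun x hx => ?_⟩
  · rw [Matrix.mem_unitaryGroup_iff']
    ext x y
    have := orthonormal_iff_ite.1 u.orthonormal x y
    rw [PiLp.inner_apply] at this
    rw [Matrix.mul_apply, Matrix.one_apply, ← this]
    refine Finset.sum_congr rfl fun z _ => ?_
    simp [Matrix.star_apply, mul_comm]
  · ext y
    rw [mulVec_ket_apply]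
    exact congrFun (congrArg WithLp.ofLp (hu x hx)) y

/-- A pair of wires. -/
def pair {a c : ι} (h : a ≠ c) : Fin 2 ↪ ι where
  toFun := ![a, c]
  inj' i j hij := by
    fin_cases i <;> fin_cases j <;> simp_all [eq_comm]

theorem comp_pair {a c : ι} (h : a ≠ c) (x : ι → Bool) : x ∘ pair h = ![x a, x c] := by
  ext i
  fin_cases i <;> rfl

theorem extend_pair [DecidableEq ι] {a c : ι} (h : a ≠ c) (x : ι → Bool) (p q : Bool) :
    Function.extend (pair h) ![p, q] x = Function.update (Function.update x a p) c q := by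
  ext i
  by_cases hc : i = c
  · subst hc
    rw [Function.update_self]
    exact (pair h).injective.extend_apply ![p, q] x 1
  rw [Function.update_of_ne hc]
  by_cases ha : i = a
  · subst ha
    rw [Function.update_self]
    exact (pair h).injective.extend_apply ![p, q] x 0
  rw [Function.update_of_ne ha, Function.extend_apply']
  rintro ⟨j, hj⟩
  fin_cases j
  · exact ha hj.symm
  · exact hc hj.symm

theorem sum_fin_two_bool {M : Type*} [AddCommMonoid M] (f : (Fin 2 → Bool) → M) :
    ∑ x, f x = ∑ p, ∑ q, f ![p, q] := by
  rw [← (finTwoArrowEquiv Bool).symm.sum_comp, Fintype.sum_prod_type]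
  rfl

variable [Fintype ι] [DecidableEq ι]

/-- There is a two-qubit gate with prescribed orthonormal images `v` and `v'` of the states
`|0⟩|0⟩` and `|1⟩|0⟩`. -/
theorem exists_encodes_pair {a c : ι} (h : a ≠ c) {v v' : Bool → Bool → ℂ}
    (hv : ∑ p, ∑ q, star (v p q) * v p q = 1) (hv' : ∑ p, ∑ q, star (v' p q) * v' p q = 1)
    (hvv : ∑ p, ∑ q, star (v p q) * v' p q = 0) :
    ∃ U : Matrix (ι → Bool) (ι → Bool) ℂ, Encodes 1 (fun _ : Oracles w b => U) ∧
      (∀ x, x a = false → x c = false →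
        U *ᵥ ket x = ∑ p, ∑ q, v p q • ket (Function.update (Function.update x a p) c q)) ∧
      ∀ x, x a = true → x c = false →
        U *ᵥ ket x = ∑ p, ∑ q, v' p q • ket (Function.update (Function.update x a p) c q) := by
  have hvv' : ∑ p, ∑ q, star (v' p q) * v p q = 0 := by
    rw [← star_zero, ← hvv, star_sum]
    refine Finset.sum_congr rfl fun p _ => ?_
    rw [star_sum]
    refine Finset.sum_congr rfl fun q _ => ?_
    rw [star_mul, star_star, mul_comm]
  obtain ⟨G, hG⟩ := exists_unitary_mulVec_ket {x : Fin 2 → Bool | x 1 = false}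
    (fun x y => if x 0 then v' (y 0) (y 1) else v (y 0) (y 1)) (by
      intro x hx y hy
      have hxy : x = y ↔ x 0 = y 0 := by
        refine ⟨fun h => by rw [h], fun h => funext fun i => ?_⟩
        fin_cases i
        · exact h
        · exact hx.trans (Eq.symm hy)
      rw [dotProduct, sum_fin_two_bool]
      simp only [hxy, Pi.star_apply, Matrix.cons_val_zero, Matrix.cons_val_one]
      cases x 0 <;> cases y 0 <;> simp only [if_true, Bool.false_eq_true, if_false, reduceCtorEq]
      · exact hv
      · exact hvv
      · exact hvv'
      · exact hv')
  have key : ∀ x : ι → Bool, x c = false → onWires (pair h) G.1 *ᵥ ket x =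
      ∑ p, ∑ q, (if x a then v' p q else v p q) •
        ket (Function.update (Function.update x a p) c q) := by
    intro x hx
    rw [onWires_mulVec_ket, comp_pair, hG _ (by exact hx),
      pi_eq_sum_ket (fun y : Fin 2 → Bool => _), map_sum, sum_fin_two_bool]
    refine Finset.sum_congr rfl fun p _ => Finset.sum_congr rfl fun q _ => ?_
    rw [map_smul, lift_ket, extend_pair]
    rfl
  refine ⟨onWires (pair h) G.1, Encodes.of_step (.gate2 G _), fun x ha hx => ?_, fun x ha hx => ?_⟩
  · simp only [key x hx, ha, Bool.false_eq_true, if_false]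
  · simp only [key x hx, ha, if_true]

theorem diagonal_mem_unitaryGroup {κ : Type} [Fintype κ] [DecidableEq κ] {d : κ → ℂ}
    (hd : ∀ x, ‖d x‖ = 1) : Matrix.diagonal d ∈ Matrix.unitaryGroup κ ℂ := by
  rw [Matrix.mem_unitaryGroup_iff, Matrix.star_eq_conjTranspose, Matrix.diagonal_conjTranspose,
    Matrix.diagonal_mul_diagonal, ← Matrix.diagonal_one]
  congr 1
  ext x
  rw [Pi.star_apply, ← starRingEnd_apply, Complex.mul_conj, Complex.normSq_eq_norm_sq, hd]
  norm_num

theorem encodes_diagonal_one (a : ι) {d : Bool → ℂ} (hd : ∀ x, ‖d x‖ = 1) :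
    Encodes 1 fun _ : Oracles w b => Matrix.diagonal fun x : ι → Bool => d (x a) :=
  (Encodes.of_step (.gate1 ⟨Matrix.diagonal fun x : Fin 1 → Bool => d (x 0),
    diagonal_mem_unitaryGroup fun _ => hd _⟩ 
    ⟨fun _ => a, fun _ _ _ => Subsingleton.elim _ _⟩)).congr fun _ => onWires_diagonal _ _

theorem encodes_diagonal_two {a c : ι} (h : a ≠ c) {d : Bool → Bool → ℂ}
    (hd : ∀ x y, ‖d x y‖ = 1) :
    Encodes 1 fun _ : Oracles w b => Matrix.diagonal fun x : ι → Bool => d (x a) (x c) :=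
  (Encodes.of_step (.gate2 ⟨Matrix.diagonal fun x : Fin 2 → Bool => d (x 0) (x 1),
    diagonal_mem_unitaryGroup fun _ => hd _ _⟩ (pair h))).congr fun _ => onWires_diagonal _ _

theorem exists_encodes_not (a : ι) :
    ∃ U : Matrix (ι → Bool) (ι → Bool) ℂ, Encodes 1 (fun _ : Oracles w b => U) ∧
      ∀ x, x a = true → U *ᵥ ket x = ket (Function.update x a false) := by
  obtain ⟨G, hG⟩ := exists_unitary_mulVec_ket {fun _ : Fin 1 => true}
    (fun _ => ket fun _ => false) (by
      rintro x rfl y rfl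
      simp [dotProduct, ket_apply])
  refine ⟨_, Encodes.of_step (.gate1 G ⟨fun _ => a, fun _ _ _ => Subsingleton.elim _ _⟩),
    fun x hx => onWires_mulVec_ket_of_eq_ket (hG _ (funext fun _ => hx)) ?_⟩
  ext i
  by_cases hi : i = a
  · subst hi
    rw [Function.update_self]
    exact Function.Injective.extend_apply (f := fun _ : Fin 1 => i)
      (fun _ _ _ => Subsingleton.elim _ _) _ _ 0
  · rw [Function.update_of_ne hi, Function.extend_apply']
    rintro ⟨j, hj⟩
    exact hi hj.symm

theorem exists_encodes_swap {a c : ι} (h : a ≠ c) :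
    ∃ U : Matrix (ι → Bool) (ι → Bool) ℂ, Encodes 1 (fun _ : Oracles w b => U) ∧
      ∀ x, U *ᵥ ket x = ket (x ∘ Equiv.swap a c) := by
  obtain ⟨G, hG⟩ := exists_unitary_mulVec_ket Set.univ
    (fun x : Fin 2 → Bool => ket ![x 1, x 0]) (by
      intro x _ y _
      have : ![x 1, x 0] = ![y 1, y 0] ↔ x = y := by
        rw [funext_iff, funext_iff, Fin.forall_fin_two, Fin.forall_fin_two]
        exact and_comm
      rw [dotProduct, Finset.sum_eq_single ![y 1, y 0]]
      · simp only [Pi.star_apply, ket_apply, eq_comm (a := ![y 1, y 0]), this, if_true, mul_one]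
        split_ifs <;> simp
      · intro z _ hz
        rw [ket_of_ne hz, mul_zero]
      · simp)
  refine ⟨_, Encodes.of_step (.gate2 G (pair h)),
    fun x => onWires_mulVec_ket_of_eq_ket (hG _ trivial) ?_⟩
  rw [extend_pair]
  ext i
  rw [Function.comp_apply (f := x) (g := Equiv.swap a c)]
  by_cases hc : i = c
  · subst hc
    rw [Function.update_self, Equiv.swap_apply_right]
    rfl
  rw [Function.update_of_ne hc]
  by_cases ha : i = a
  · subst ha
    rw [Function.update_self, Equiv.swap_apply_left]
    rfl
  rw [Function.update_of_ne ha, Equiv.swap_apply_of_ne_of_ne ha hc]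

end Gates

/-! ### Uniform superpositions -/

section Uniform

variable {w b : ℕ}

/-- The basis state of a register of `m` qubits that holds `l`, next to one more qubit. -/
def numState (m l : ℕ) (β : Bool) : Fin m ⊕ Unit → Bool := Sum.elim (bits m l) fun _ => β

theorem bits_zero (m : ℕ) : bits m 0 = fun _ => false := by
  ext i
  simp [bits]

theorem bits_injOn {m i j : ℕ} (hi : i < 2 ^ m) (hj : j < 2 ^ m) (h : bits m i = bits m j) :
    i = j := by
  refine Nat.eq_of_testBit_eq fun l => ?_
  by_cases hl : l < m
  · exact congrFun h ⟨l, hl⟩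
  · have := Nat.pow_le_pow_right two_pos (not_lt.1 hl)
    rw [Nat.testBit_lt_two_pow (hi.trans_le this), Nat.testBit_lt_two_pow (hj.trans_le this)]

theorem extend_numState {m l : ℕ} (hl : l < 2 ^ m) (q β : Bool) (x : Fin (m + 1) ⊕ Unit → Bool)
    (hx : x (Sum.inl (Fin.last m)) = q) :
    Function.extend (sumEmb Fin.castSuccEmb (.refl Unit)) (numState m l β) x =
      numState (m + 1) ((if q then 2 ^ m else 0) + l) β := by
  have h := (sumEmb (Fin.castSuccEmb (n := m)) (.refl Unit)).injective.extend_apply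
    (numState m l β) x
  ext (i | i)
  · cases i using Fin.lastCases with
    | last =>
      rw [Function.extend_apply', hx]
      · cases q
        · simpa [numState, bits] using (Nat.testBit_lt_two_pow hl)
        · simpa [numState, bits, Nat.testBit_two_pow_add_eq] using (Nat.testBit_lt_two_pow hl)
      · rintro ⟨j | j, hj⟩
        · exact (Fin.castSucc_lt_last j).ne (Sum.inl.inj hj)
        · cases hj
    | cast i =>
      refine (h (Sum.inl i)).trans ?_
      cases q
      · simp [numState, bits]
      · simp [numState, bits, Nat.testBit_two_pow_add_gt i.2]
  · exact h (Sum.inr i)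

/-- For each `r ≤ 2 ^ m`, about `m` gates turn the two states `|0⟩|0⟩` and `|0⟩|1⟩` into uniform
superpositions over `[0, r)` and over `[r, 2 ^ m)`. These two are orthogonal, and cutting the top
digit off expresses both of them through the two superpositions for `m - 1` digits; so one two-qubit
gate, on the extra qubit and the top digit, reduces `m` to `m - 1`. -/
theorem exists_encodes_uniform (m r : ℕ) (hr : r ≤ 2 ^ m) :
    ∃ P : Matrix (Fin m ⊕ Unit → Bool) (Fin m ⊕ Unit → Bool) ℂ,
      Encodes (m + 1) (fun _ : Oracles w b => P) ∧
      (√r : ℂ) • P *ᵥ ket (numState m 0 false) = ∑ l ∈ Finset.range r, ket (numState m l false) ∧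
      (√(2 ^ m - r) : ℂ) • P *ᵥ ket (numState m 0 true) =
        ∑ l ∈ Finset.Ico r (2 ^ m), ket (numState m l false) := by
  induction m generalizing r with
  | zero =>
    rw [pow_zero] at hr
    -- Only one of the two ranges is nonempty; its superposition has to end with the extra qubit
    -- in the state `|0⟩`.
    interval_cases r
    · obtain ⟨U, hU, hU1⟩ := exists_encodes_not (w := w) (b := b) (Sum.inr () : Fin 0 ⊕ Unit)
      refine ⟨U, hU, by simp, ?_⟩
      rw [hU1 _ rfl]
      have : Function.update (numState 0 0 true) (Sum.inr ()) false = numState 0 0 false := by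
        ext (i | i)
        · exact i.elim0
        · simp [numState]
      simp [this]
    · exact ⟨1, Encodes.one.mono zero_le_one, by simp, by simp⟩
  | succ m ih =>
    have hne : (Sum.inr () : Fin (m + 1) ⊕ Unit) ≠ Sum.inl (Fin.last m) := by simp
    -- The lower digits, for either value `q` of the top digit.
    have low : ∀ r : ℕ, r ≤ 2 ^ m →
        ∃ P : Matrix (Fin (m + 1) ⊕ Unit → Bool) (Fin (m + 1) ⊕ Unit → Bool) ℂ,
        Encodes (m + 1) (fun _ : Oracles w b => P) ∧ ∀ (β' q : Bool),
        ((√r : ℂ) • P *ᵥ ket (Function.update (Function.update (numState (m + 1) 0 β')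
            (Sum.inr ()) false) (Sum.inl (Fin.last m)) q) =
          ∑ l ∈ Finset.range r, ket (numState (m + 1) ((if q then 2 ^ m else 0) + l) false)) ∧
        (√(2 ^ m - r) : ℂ) • P *ᵥ ket (Function.update (Function.update (numState (m + 1) 0 β')
            (Sum.inr ()) true) (Sum.inl (Fin.last m)) q) =
          ∑ l ∈ Finset.Ico r (2 ^ m),
            ket (numState (m + 1) ((if q then 2 ^ m else 0) + l) false) := by
      intro r hr
      obtain ⟨P, hP, h0, h1⟩ := ih r hr
      have hcomp : ∀ β' β q : Bool, Function.update (Function.update (numState (m + 1) 0 β')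
          (Sum.inr ()) β) (Sum.inl (Fin.last m)) q ∘ sumEmb Fin.castSuccEmb (.refl Unit) =
          numState m 0 β := by
        intro β' β q
        ext (i | i)
        · have h1 : Sum.inl i.castSucc ≠ (Sum.inl (Fin.last m) : Fin (m + 1) ⊕ Unit) :=
            fun h => (Fin.castSucc_lt_last i).ne (Sum.inl.inj h)
          have h2 : Sum.inl i.castSucc ≠ (Sum.inr () : Fin (m + 1) ⊕ Unit) := Sum.inl_ne_inr
          refine (Function.update_of_ne h1 _ _).trans ((Function.update_of_ne h2 _ _).trans ?_)
          simp [numState, bits_zero]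
        · refine (Function.update_of_ne Sum.inr_ne_inl _ _).trans ?_
          exact Function.update_self _ _ _
      refine ⟨_, hP.onWires (sumEmb Fin.castSuccEmb (.refl Unit)), fun β' q => ⟨?_, ?_⟩⟩
      · rw [onWires_mulVec_ket, hcomp, ← map_smul, h0, map_sum]
        refine Finset.sum_congr rfl fun l hl => ?_
        rw [lift_ket, extend_numState ((Finset.mem_range.1 hl).trans_le hr) q _ _ (by simp)]
      · rw [onWires_mulVec_ket, hcomp, ← map_smul, h1, map_sum]
        refine Finset.sum_congr rfl fun l hl => ?_
        rw [lift_ket, extend_numState (Finset.mem_Ico.1 hl).2 q _ _ (by simp)]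
    have shift : ∀ i j : ℕ, ∑ l ∈ Finset.Ico i j, ket (numState (m + 1) (2 ^ m + l) false) =
        ∑ l ∈ Finset.Ico (2 ^ m + i) (2 ^ m + j), ket (numState (m + 1) l false) := by
      intro i j
      rw [Finset.sum_Ico_add (fun l => ket (numState (m + 1) l false)), add_comm i, add_comm j]
    have hdiv : ∀ x y : ℝ, 0 < y → (√y : ℂ) * ((√x / √y : ℝ) : ℂ) = √x := by
      intro x y hy
      rw [← Complex.ofReal_mul, mul_div_cancel₀ _ (Real.sqrt_pos.2 hy).ne']
    have hN : (0 : ℝ) < 2 ^ m := by positivity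
    by_cases hrm : r ≤ 2 ^ m
    -- The range `[0, r)` lies in the lower half, and `[r, 2 ^ (m + 1))` is the union of
    -- `[r, 2 ^ m)` in the lower half with both ranges of the upper half.
    · obtain ⟨P, hP, hlow⟩ := low r hrm
      have hα : (0 : ℝ) ≤ r := Nat.cast_nonneg r
      have hrm' : (r : ℝ) ≤ 2 ^ m := by exact_mod_cast hrm
      have hβ : (0 : ℝ) ≤ 2 ^ m - r := sub_nonneg.2 hrm'
      have hD : (0 : ℝ) < 2 ^ (m + 1) - r := by rw [pow_succ]; linarith
      obtain ⟨U, hU, hU0, hU1⟩ := exists_encodes_pair (w := w) (b := b) hne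
        (v := fun p q => if p || q then 0 else 1)
        (v' := fun p q => if p then ((√(2 ^ m - r) / √(2 ^ (m + 1) - r) : ℝ) : ℂ) else
          if q then ((√r / √(2 ^ (m + 1) - r) : ℝ) : ℂ) else 0)
        (by simp) (by
          simp only [Fintype.sum_bool, if_true, Bool.false_eq_true, if_false,
            ← starRingEnd_apply, Complex.conj_ofReal, ← Complex.ofReal_mul, div_mul_div_comm,
            Real.mul_self_sqrt hα, Real.mul_self_sqrt hβ, Real.mul_self_sqrt hD.le, map_zero,
            mul_zero, add_zero, ← Complex.ofReal_add]
          rw [Complex.ofReal_eq_one]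
          field_simp
          ring) (by simp)
      refine ⟨P * U, (hP.mul hU).mono (by omega), ?_, ?_⟩
      · rw [← Matrix.mulVec_mulVec, hU0 _ rfl (by simp [numState, bits_zero])]
        simpa using (hlow false false).1
      · rw [← Matrix.mulVec_mulVec, hU1 _ rfl (by simp [numState, bits_zero])]
        simp only [Fintype.sum_bool, if_true, Bool.false_eq_true, if_false, zero_smul, add_zero,
          Matrix.mulVec_add, Matrix.mulVec_smul, smul_add, smul_smul, hdiv _ _ hD]
        have h1 := (hlow true true).2
        have h2 := (hlow true false).2
        have h3 := (hlow true true).1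
        simp only [if_true, Bool.false_eq_true, if_false, zero_add] at h1 h2 h3
        rw [h1, h2, h3, Finset.range_eq_Ico, shift, shift, add_zero, pow_succ, mul_two,
          ← Finset.sum_Ico_consecutive _ hrm (Nat.le_add_right _ _),
          ← Finset.sum_Ico_consecutive _ (Nat.le_add_right (2 ^ m) r) (Nat.add_le_add_left hrm _)]
        abel
    -- The range `[r, 2 ^ (m + 1))` lies in the upper half, where it is `[a, 2 ^ m)`, and `[0, r)`
    -- is the union of both ranges of the lower half with `[0, a)` in the upper half.
    · obtain ⟨a, rfl⟩ := Nat.exists_eq_add_of_le (not_le.1 hrm).le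
      have ham : a ≤ 2 ^ m := by rw [pow_succ] at hr; omega
      obtain ⟨P, hP, hlow⟩ := low a ham
      have hα : (0 : ℝ) ≤ a := Nat.cast_nonneg a
      have ham' : (a : ℝ) ≤ 2 ^ m := by exact_mod_cast ham
      have hβ : (0 : ℝ) ≤ 2 ^ m - a := sub_nonneg.2 ham'
      have hD : (0 : ℝ) < 2 ^ m + a := by positivity
      obtain ⟨U, hU, hU0, hU1⟩ := exists_encodes_pair (w := w) (b := b) hne
        (v := fun p q => if p then if q then 0 else ((√(2 ^ m - a) / √(2 ^ m + a) : ℝ) : ℂ) else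
          ((√a / √(2 ^ m + a) : ℝ) : ℂ))
        (v' := fun p q => if p && q then 1 else 0)
        (by
          simp only [Fintype.sum_bool, if_true, Bool.false_eq_true, if_false,
            ← starRingEnd_apply, Complex.conj_ofReal, ← Complex.ofReal_mul, div_mul_div_comm,
            Real.mul_self_sqrt hα, Real.mul_self_sqrt hβ, Real.mul_self_sqrt hD.le, map_zero,
            mul_zero, zero_add, ← Complex.ofReal_add]
          rw [Complex.ofReal_eq_one]
          field_simp
          ring) (by simp) (by simp)
      have hcast : ((2 ^ m + a : ℕ) : ℝ) = 2 ^ m + a := by push_cast; rfl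
      have hsub : (2 : ℝ) ^ (m + 1) - (2 ^ m + a) = 2 ^ m - a := by ring
      rw [hcast, hsub]
      refine ⟨P * U, (hP.mul hU).mono (by omega), ?_, ?_⟩
      · rw [← Matrix.mulVec_mulVec, hU0 _ rfl (by simp [numState, bits_zero])]
        simp only [Fintype.sum_bool, if_true, Bool.false_eq_true, if_false, zero_smul, zero_add,
          Matrix.mulVec_add, Matrix.mulVec_smul, smul_add, smul_smul, hdiv _ _ hD]
        have h1 := (hlow false false).2
        have h2 := (hlow false true).1
        have h3 := (hlow false false).1
        simp only [if_true, Bool.false_eq_true, if_false, zero_add] at h1 h2 h3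
        rw [h1, h2, h3, Finset.range_eq_Ico, Finset.range_eq_Ico, shift, add_zero,
          ← Finset.sum_Ico_consecutive _ (Nat.zero_le _) (Nat.le_add_right (2 ^ m) a),
          ← Finset.sum_Ico_consecutive _ (Nat.zero_le _) ham]
        abel
      · rw [← Matrix.mulVec_mulVec, hU1 _ rfl (by simp [numState, bits_zero])]
        have h1 := (hlow true true).2
        simp only [if_true] at h1
        simp [h1, shift, pow_succ, mul_two]

end Uniform

/-! ### Diagonal operators -/

section Diagonal

variable {w b : ℕ} {κ : Type}

theorem update_sumElim_unit {ι : Type} [DecidableEq ι] (x : ι → Bool) (a : ι) (r p q : Bool) :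
    Function.update (Function.update (Sum.elim x fun _ : Unit => r) (Sum.inl a) p) (Sum.inr ()) q =
      Sum.elim (Function.update x a p) fun _ => q := by
  rw [Sum.update_elim_inl, Sum.update_elim_inr]
  congr 1

theorem sumElim_unit_inj {ι : Type} {u v : ι → Bool} {p q : Bool} :
    (Sum.elim u (fun _ => p) : ι ⊕ Unit → Bool) = Sum.elim v (fun _ => q) ↔ u = v ∧ p = q := by
  rw [Sum.elim_eq_iff, funext_iff (f := fun _ : Unit => p), Unique.forall_iff]

theorem ket_sumElim_unit [DecidableEq (κ → Bool)] (u v : κ → Bool) (p q : Bool) :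
    ket (Sum.elim v fun _ : Unit => q) (Sum.elim u fun _ => p) =
      if u = v ∧ p = q then 1 else 0 := by
  classical
  rw [ket_apply]
  exact if_congr sumElim_unit_inj rfl rfl

variable [Fintype κ] [DecidableEq κ]

theorem conjTranspose_mul_diagonal_mul_apply (S : Matrix (κ → Bool) (κ → Bool) ℂ)
    (d : (κ → Bool) → ℂ) (u v : κ → Bool) :
    (Sᴴ * (Matrix.diagonal d * S)) u v =
      ∑ z, star ((S *ᵥ ket u) z) * (d z * (S *ᵥ ket v) z) := by
  rw [Matrix.mul_apply]
  refine Finset.sum_congr rfl fun z _ => ?_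
  rw [Matrix.conjTranspose_apply, Matrix.diagonal_mul, mulVec_ket_apply, mulVec_ket_apply]

/-- The diagonal operator with entries `g`, controlled by one more qubit. -/
def controlled (g : (κ → Bool) → ℂ) : Matrix (κ ⊕ Unit → Bool) (κ ⊕ Unit → Bool) ℂ :=
  Matrix.diagonal fun x => if x (Sum.inr ()) then g (x ∘ Sum.inl) else 1

theorem sum_star_ket_mul (u : κ → Bool) (f : (κ → Bool) → ℂ) :
    ∑ z, star (ket u z) * f z = f u := by
  rw [Finset.sum_eq_single u]
  · rw [ket_self, star_one, one_mul]
  · intro z _ hz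
    rw [ket_of_ne hz, star_zero, zero_mul]
  · simp

/-- Half of the excitation of the control qubit is moved to a fresh qubit, and the two operators are
controlled by one of these two qubits each. Undoing the splitting leaves the average of the two
operators; if the control qubit is in the state `|0⟩`, nothing happens. -/
theorem Encodes.controlled_average {t t' : ℕ} {g g' : (κ → Bool) → ℂ}
    (h : Encodes t fun _ : Oracles w b => controlled g)
    (h' : Encodes t' fun _ : Oracles w b => controlled g') :
    Encodes (t + t' + 2) fun _ : Oracles w b => controlled fun x => (g x + g' x) / 2 := by
  have hne : (Sum.inl (Sum.inr ()) : (κ ⊕ Unit) ⊕ Unit) ≠ Sum.inr () := Sum.inl_ne_inr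
  have h2 : (√2 : ℂ)⁻¹ * (√2 : ℂ)⁻¹ = 1 / 2 := by
    rw [← mul_inv, ← Complex.ofReal_mul, Real.mul_self_sqrt zero_le_two]
    norm_num
  obtain ⟨S, hS, hS0, hS1⟩ := exists_encodes_pair (w := w) (b := b) hne
    (v := fun p q => if p || q then 0 else 1)
    (v' := fun p q => if p = q then 0 else (√2 : ℂ)⁻¹)
    (by simp) (by
      simp [← starRingEnd_apply, Complex.conj_ofReal, h2]
      norm_num) (by simp)
  have key := ((hS.conjTranspose).mul (((h.onWires .inl).mul
    (h'.onWires (sumEmb .inl (.refl Unit)))).mul hS)).block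
  refine (key.mono (by omega)).congr fun _ => ?_
  obtain ⟨d, hprod, hd⟩ : ∃ d : ((κ ⊕ Unit) ⊕ Unit → Bool) → ℂ,
      SparseQuantum.onWires .inl (controlled g) *
        SparseQuantum.onWires (sumEmb .inl (.refl Unit)) (controlled g') = Matrix.diagonal d ∧
      ∀ (x : κ ⊕ Unit → Bool) (p : Bool), d (Sum.elim x fun _ => p) =
        (if x (Sum.inr ()) then g (x ∘ Sum.inl) else 1) *
          (if p then g' (x ∘ Sum.inl) else 1) := by
    refine ⟨fun z => (if z (Sum.inl (Sum.inr ())) then g (z ∘ Sum.inl ∘ Sum.inl) else 1) *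
      (if z (Sum.inr ()) then g' (z ∘ Sum.inl ∘ Sum.inl) else 1), ?_, fun x p => rfl⟩
    rw [controlled, controlled, onWires_diagonal, onWires_diagonal, Matrix.diagonal_mul_diagonal]
    rfl
  rw [hprod, controlled]
  ext x y
  rw [SparseQuantum.block, Matrix.of_apply, conjTranspose_mul_diagonal_mul_apply,
    Matrix.diagonal_apply]
  have f0 : ∀ x : κ ⊕ Unit → Bool, x (Sum.inr ()) = false →
      S *ᵥ ket (Sum.elim x fun _ => false) = ket (Sum.elim x fun _ => false) := by
    intro x hx
    rw [hS0 _ hx rfl]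
    simp only [update_sumElim_unit, Fintype.sum_bool, Bool.true_or, Bool.or_true, Bool.or_self,
      if_true, Bool.false_eq_true, if_false, zero_smul, one_smul, zero_add]
    rw [Function.update_eq_self_iff.2 hx.symm]
  have f1 : ∀ x : κ ⊕ Unit → Bool, x (Sum.inr ()) = true →
      S *ᵥ ket (Sum.elim x fun _ => false) = (√2 : ℂ)⁻¹ • (ket (Sum.elim x fun _ => false) +
        ket (Sum.elim (Function.update x (Sum.inr ()) false) fun _ => true)) := by
    intro x hx
    rw [hS1 _ hx rfl]
    simp only [update_sumElim_unit, Fintype.sum_bool, if_true, reduceCtorEq, if_false, zero_smul,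
      zero_add, add_zero, smul_add]
    rw [Function.update_eq_self_iff.2 hx.symm]
  have hs1 : ∀ u u' (f : ((κ ⊕ Unit) ⊕ Unit → Bool) → ℂ),
      ∑ z, star (((√2 : ℂ)⁻¹ • (ket u + ket u')) z) * f z = (√2 : ℂ)⁻¹ * (f u + f u') := by
    intro u u' f
    rw [← sum_star_ket_mul u f, ← sum_star_ket_mul u' f, ← Finset.sum_add_distrib, Finset.mul_sum]
    refine Finset.sum_congr rfl fun z _ => ?_
    rw [Pi.smul_apply, Pi.add_apply, smul_eq_mul, star_mul, star_add,
      show star (√2 : ℂ)⁻¹ = (√2 : ℂ)⁻¹ by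
        rw [← starRingEnd_apply, map_inv₀, Complex.conj_ofReal]]
    ring
  have hc : Function.update x (Sum.inr ()) false ∘ Sum.inl = x ∘ Sum.inl :=
    funext fun i => Function.update_of_ne Sum.inl_ne_inr _ _
  cases hx : x (Sum.inr ()) <;> cases hy : y (Sum.inr ())
  · rw [f0 x hx, f0 y hy, sum_star_ket_mul, ket_sumElim_unit, hd]
    simp [hx]
  · have : x ≠ y := fun h => Bool.false_ne_true (hx.symm.trans (h ▸ hy))
    rw [f0 x hx, f1 y hy, sum_star_ket_mul, Pi.smul_apply, Pi.add_apply, ket_sumElim_unit,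
      ket_sumElim_unit]
    simp [this]
  · have : x ≠ y := fun h => Bool.false_ne_true (hy.symm.trans (h ▸ hx))
    rw [f1 x hx, f0 y hy, hs1, ket_sumElim_unit, ket_sumElim_unit]
    simp only [this, false_and, Bool.true_eq_false, and_false, if_false, mul_zero, add_zero]
  · have : Function.update x (Sum.inr ()) false = Function.update y (Sum.inr ()) false ↔ x = y := by
      refine ⟨fun h => funext fun i => ?_, fun h => by rw [h]⟩
      rcases i with i | i
      · exact ((Function.update_of_ne Sum.inl_ne_inr _ _).symm.trans
          (congrFun h (Sum.inl i))).trans (Function.update_of_ne Sum.inl_ne_inr _ _)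
      · exact hx.trans hy.symm
    rw [f1 x hx, f1 y hy, hs1]
    simp only [Pi.smul_apply, Pi.add_apply, ket_sumElim_unit, this, hd, hc, hx,
      Function.update_self, if_true, Bool.false_eq_true, Bool.true_eq_false, if_false, and_false,
      and_true, smul_eq_mul, add_zero, zero_add, mul_one, one_mul]
    split_ifs
    · linear_combination (g (x ∘ Sum.inl) + g' (x ∘ Sum.inl)) * h2
    · ring

/-- Clipping: where the wire `t` carries `1`, the factor `g` is replaced by `1`. -/
theorem Encodes.clip {t : ℕ} {g : (κ → Bool) → ℂ}
    (h : Encodes t fun _ : Oracles w b => controlled g) (a : κ) :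
    Encodes (t + 2) fun _ : Oracles w b => Matrix.diagonal fun x => if x a then 1 else g x := by
  have hne : (Sum.inl a : κ ⊕ Unit) ≠ Sum.inr () := Sum.inl_ne_inr
  obtain ⟨S, hS, hS0, hS1⟩ := exists_encodes_pair (w := w) (b := b) hne
    (v := fun p q => if !p && q then 1 else 0)
    (v' := fun p q => if p && !q then 1 else 0)
    (by simp) (by simp) (by simp)
  refine (((hS.conjTranspose).mul (h.mul hS)).block.mono (by omega)).congr fun _ => ?_
  simp only [controlled]
  ext x y
  rw [SparseQuantum.block, Matrix.of_apply, conjTranspose_mul_diagonal_mul_apply,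
    Matrix.diagonal_apply]
  have f : ∀ x : κ → Bool,
      S *ᵥ ket (Sum.elim x fun _ => false) = ket (Sum.elim x fun _ => !(x a)) := by
    intro x
    cases hx : x a
    · rw [hS0 _ hx rfl]
      simp only [update_sumElim_unit, Fintype.sum_bool, Bool.not_true, Bool.not_false,
        Bool.and_self, Bool.and_false, Bool.false_and, if_true, Bool.false_eq_true, if_false,
        zero_smul, one_smul, zero_add, add_zero]
      rw [Function.update_eq_self_iff.2 hx.symm]
    · rw [hS1 _ hx rfl]
      simp only [update_sumElim_unit, Fintype.sum_bool, Bool.not_true, Bool.not_false,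
        Bool.and_self, Bool.and_false, Bool.false_and, if_true, Bool.false_eq_true, if_false,
        zero_smul, one_smul, zero_add, add_zero]
      rw [Function.update_eq_self_iff.2 hx.symm]
  have inj : x = y ∧ (!(x a)) = !(y a) ↔ x = y := ⟨fun h => h.1, fun h => ⟨h, by rw [h]⟩⟩
  rw [f, f, sum_star_ket_mul, ket_sumElim_unit]
  simp only [inj, Sum.elim_inr, Sum.elim_comp_inl]
  cases x a <;> simp

end Diagonal

/-! ### Truncated binary expansions -/

/-- The binary digit of `N / 2 ^ b` with weight `(1 / 2) ^ (i + 1)`. -/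
def digit (b N i : ℕ) : Bool := decide (i < b) && N.testBit (b - 1 - i)

/-- The number `N / 2 ^ b`, truncated to its first `m` binary digits after the point. -/
def truncation (b N m : ℕ) : ℝ :=
  ∑ i ∈ Finset.range m, if digit b N i then (1 / 2) ^ (i + 1) else 0

theorem truncation_eq_floor {b N : ℕ} (hN : N < 2 ^ b) (m : ℕ) :
    truncation b N m = (N * 2 ^ m / 2 ^ b : ℕ) / 2 ^ m := by
  induction m with
  | zero => simp [truncation, Nat.div_eq_of_lt hN]
  | succ m ih =>
    have key : N * 2 ^ (m + 1) / 2 ^ b = 2 * (N * 2 ^ m / 2 ^ b) + (digit b N m).toNat := by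
      rcases lt_or_ge m b with h | h
      · obtain ⟨c, rfl⟩ := Nat.exists_eq_add_of_lt h
        have h1 : N * 2 ^ (m + 1) / 2 ^ (m + c + 1) = N / 2 ^ c := by
          rw [show m + c + 1 = c + (m + 1) by ring, pow_add 2 c (m + 1)]
          exact Nat.mul_div_mul_right _ _ (by positivity)
        have h2 : N * 2 ^ m / 2 ^ (m + c + 1) = N / 2 ^ c / 2 := by
          rw [show m + c + 1 = c + 1 + m by ring, pow_add 2 (c + 1) m,
            Nat.mul_div_mul_right _ _ (by positivity), pow_succ, Nat.div_div_eq_div_mul]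
        have h3 : digit (m + c + 1) N m = decide (N / 2 ^ c % 2 = 1) := by
          rw [digit, show m + c + 1 - 1 - m = c by omega, Nat.testBit_eq_decide_div_mod_eq]
          simp [show m < m + c + 1 by omega]
        rw [h1, h2, h3]
        by_cases h4 : N / 2 ^ c % 2 = 1 <;> simp [h4] <;> omega
      · obtain ⟨c, rfl⟩ := Nat.exists_eq_add_of_le h
        have h3 : digit b N (b + c) = false := by simp [digit]
        have h4 : ∀ d, N * 2 ^ (b + d) / 2 ^ b = N * 2 ^ d := fun d => by
          rw [pow_add, mul_left_comm, Nat.mul_div_cancel_left _ (by positivity)]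
        rw [h3, h4, add_assoc, h4, pow_succ, Bool.toNat_false]
        ring
    rw [truncation, Finset.sum_range_succ, ← truncation, ih, key]
    cases digit b N m
    · simp [pow_succ]
      field_simp
    · simp [pow_succ]
      field_simp

theorem truncation_le {b N : ℕ} (hN : N < 2 ^ b) (m : ℕ) : truncation b N m ≤ N / 2 ^ b := by
  rw [truncation_eq_floor hN, div_le_div_iff₀ (by positivity) (by positivity)]
  exact_mod_cast Nat.div_mul_le_self _ _

theorem le_truncation_add {b N : ℕ} (hN : N < 2 ^ b) (m : ℕ) :
    (N / 2 ^ b : ℝ) ≤ truncation b N m + 1 / 2 ^ m := by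
  rw [truncation_eq_floor hN, ← add_div, div_le_div_iff₀ (by positivity) (by positivity)]
  have := Nat.lt_div_mul_add (a := N * 2 ^ m) (b := 2 ^ b) (by positivity)
  have h : N * 2 ^ m ≤ (N * 2 ^ m / 2 ^ b + 1) * 2 ^ b := by rw [add_mul, one_mul]; exact this.le
  exact_mod_cast h

theorem truncation_nonneg (b N m : ℕ) : 0 ≤ truncation b N m :=
  Finset.sum_nonneg fun i _ => by split_ifs <;> positivity

/-! ### The amplitude of an entry -/

section Entry

variable {b : ℕ}

/-- The number that the qubits `c` describe, with modulus and phase truncated to `m` binary digits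
after the point, and with a modulus of at least `1` replaced by `1`. -/
def approxValue (m : ℕ) (c : Fin (b + 1) ⊕ Fin b → Bool) : ℂ :=
  ((if c (Sum.inl (Fin.last b)) then 1 else truncation b (Nat.ofBits fun i => c (Sum.inl i)) m : ℝ))
    * Complex.exp (Complex.I * (2 * Real.pi *
        truncation b (Nat.ofBits fun i => c (Sum.inr i)) m : ℝ))

theorem norm_exp_I_mul_sub_exp_I_mul_le (x y : ℝ) :
    ‖Complex.exp (Complex.I * x) - Complex.exp (Complex.I * y)‖ ≤ |x - y| := by
  have h : Complex.exp (Complex.I * x) - Complex.exp (Complex.I * y) =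
      Complex.exp (Complex.I * y) * (Complex.exp (Complex.I * (x - y : ℝ)) - 1) := by
    rw [mul_sub, mul_one, ← Complex.exp_add]
    congr 2
    push_cast
    ring
  rw [h, norm_mul, Complex.norm_exp_I_mul_ofReal, one_mul]
  exact Real.norm_exp_I_mul_ofReal_sub_one_le

/-- Moving a point outside the unit disc radially to the unit circle brings it closer to every point
of the disc. -/
theorem norm_sub_le_norm_mul_sub {u z : ℂ} {r : ℝ} (hu : ‖u‖ = 1) (hz : ‖z‖ ≤ 1) (hr : 1 ≤ r) :
    ‖u - z‖ ≤ ‖r * u - z‖ := by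
  rw [← sq_le_sq₀ (norm_nonneg _) (norm_nonneg _), ← Complex.normSq_eq_norm_sq,
    ← Complex.normSq_eq_norm_sq]
  have hu' : u.re * u.re + u.im * u.im = 1 := by
    rw [← Complex.normSq_apply, Complex.normSq_eq_norm_sq, hu, one_pow]
  have hz' : z.re * z.re + z.im * z.im ≤ 1 := by
    rw [← Complex.normSq_apply, Complex.normSq_eq_norm_sq]
    exact pow_le_one₀ (norm_nonneg _) hz
  have ht : u.re * z.re + u.im * z.im ≤ 1 := by
    nlinarith [sq_nonneg (u.re - z.re), sq_nonneg (u.im - z.im)]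
  simp only [Complex.normSq_apply, Complex.sub_re, Complex.sub_im, Complex.re_ofReal_mul,
    Complex.im_ofReal_mul]
  nlinarith [mul_nonneg (sub_nonneg.2 hr) (sub_nonneg.2 ht), sq_nonneg (r - 1)]

variable (c : Fin (b + 1) ⊕ Fin b → Bool)

theorem ofBits_lt_of_last (h : c (Sum.inl (Fin.last b)) = false) :
    (Nat.ofBits fun i => c (Sum.inl i)) < 2 ^ b := by
  refine Nat.lt_pow_two_of_testBit _ fun i hi => ?_
  rcases hi.eq_or_lt with rfl | hi
  · rw [Nat.testBit_ofBits_lt _ _ (Nat.lt_succ_self _)]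
    exact h
  · exact Nat.testBit_ofBits_ge _ _ hi

theorem le_ofBits_of_last (h : c (Sum.inl (Fin.last b)) = true) :
    2 ^ b ≤ (Nat.ofBits fun i => c (Sum.inl i)) := by
  refine Nat.ge_two_pow_of_testBit (i := b) ?_
  rw [Nat.testBit_ofBits_lt _ _ (Nat.lt_succ_self _)]
  exact h

theorem norm_approxValue_le (m : ℕ) : ‖approxValue m c‖ ≤ 1 := by
  rw [approxValue, norm_mul, Complex.norm_exp_I_mul_ofReal, mul_one, Complex.norm_real,
    Real.norm_eq_abs]
  cases h : c (Sum.inl (Fin.last b))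
  · rw [if_neg Bool.false_ne_true, abs_of_nonneg (truncation_nonneg _ _ _)]
    have := ofBits_lt_of_last c h
    refine (truncation_le this m).trans ?_
    rw [div_le_one (by positivity)]
    exact_mod_cast this.le
  · simp

theorem norm_approxValue_sub_le (m : ℕ) {z : ℂ} (hz : ‖z‖ ≤ 1) :
    ‖approxValue m c - z‖ ≤ ‖value c - z‖ + 8 / 2 ^ m := by
  set p := Nat.ofBits fun i => c (Sum.inl i) with hp
  set q := Nat.ofBits fun i => c (Sum.inr i) with hq
  set θ : ℝ := 2 * Real.pi * (q / 2 ^ b) with hθ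
  set r : ℝ := if c (Sum.inl (Fin.last b)) then 1 else p / 2 ^ b with hr
  have hvalue : value c = (p / 2 ^ b : ℝ) * Complex.exp (Complex.I * θ) := by
    rw [value, ← hp, ← hq, hθ]
    push_cast
    congr 2
    ring
  have hclip : ‖(r * Complex.exp (Complex.I * θ) : ℂ) - z‖ ≤ ‖value c - z‖ := by
    rw [hvalue, hr]
    cases h : c (Sum.inl (Fin.last b))
    · rw [if_neg Bool.false_ne_true]
    · rw [if_pos rfl, Complex.ofReal_one, one_mul]
      refine norm_sub_le_norm_mul_sub (Complex.norm_exp_I_mul_ofReal _) hz ?_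
      rw [one_le_div (by positivity)]
      exact_mod_cast le_ofBits_of_last c h
  have hr0 : 0 ≤ r := by rw [hr]; split_ifs <;> positivity
  have hm : (0 : ℝ) < 1 / 2 ^ m := by positivity
  have hq2 : q < 2 ^ b := Nat.ofBits_lt_two_pow _
  have hrm : |(if c (Sum.inl (Fin.last b)) then 1 else truncation b p m) - r| ≤ 1 / 2 ^ m := by
    rw [hr]
    cases h : c (Sum.inl (Fin.last b))
    · have hp2 := ofBits_lt_of_last c h
      rw [if_neg Bool.false_ne_true, if_neg Bool.false_ne_true, abs_le]
      constructor <;> linarith [truncation_le hp2 m, le_truncation_add hp2 m]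
    · simp
  have hr1 : r ≤ 1 := by
    rw [hr]
    cases h : c (Sum.inl (Fin.last b))
    · rw [if_neg Bool.false_ne_true, div_le_one (by positivity)]
      exact_mod_cast (ofBits_lt_of_last c h).le
    · simp
  have hθm : |2 * Real.pi * truncation b q m - θ| ≤ 7 * (1 / 2 ^ m) := by
    rw [hθ, ← mul_sub, abs_mul, abs_of_pos Real.two_pi_pos]
    have h1 : |truncation b q m - q / 2 ^ b| ≤ 1 / 2 ^ m := by
      rw [abs_le]
      constructor <;> linarith [truncation_le hq2 m, le_truncation_add hq2 m]
    have h2 : 2 * Real.pi ≤ 7 := by linarith [Real.pi_lt_d2]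
    exact mul_le_mul h2 h1 (abs_nonneg _) (by norm_num)
  have htrunc : ‖approxValue m c - r * Complex.exp (Complex.I * θ)‖ ≤ 8 / 2 ^ m := by
    rw [approxValue, ← hp, ← hq]
    set r' : ℝ := if c (Sum.inl (Fin.last b)) then 1 else truncation b p m
    set θ' : ℝ := 2 * Real.pi * truncation b q m
    have : (r' * Complex.exp (Complex.I * θ') - r * Complex.exp (Complex.I * θ) : ℂ) =
        ((r' - r : ℝ) : ℂ) * Complex.exp (Complex.I * θ') +
          r * (Complex.exp (Complex.I * θ') - Complex.exp (Complex.I * θ)) := by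
      push_cast
      ring
    rw [this]
    refine (norm_add_le _ _).trans ?_
    rw [norm_mul, norm_mul, Complex.norm_exp_I_mul_ofReal, mul_one, Complex.norm_real,
      Complex.norm_real, Real.norm_eq_abs, Real.norm_eq_abs, abs_of_nonneg hr0]
    have := (norm_exp_I_mul_sub_exp_I_mul_le θ' θ).trans hθm
    have := mul_le_mul hr1 this (norm_nonneg _) zero_le_one
    rw [show (8 : ℝ) / 2 ^ m = 1 / 2 ^ m + 1 * (7 * (1 / 2 ^ m)) by ring]
    exact add_le_add hrm this
  calc ‖approxValue m c - z‖ = ‖(r * Complex.exp (Complex.I * θ) - z) +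
        (approxValue m c - r * Complex.exp (Complex.I * θ))‖ := by congr 1; ring
    _ ≤ _ := (norm_add_le _ _).trans (add_le_add hclip htrunc)

end Entry

section EncodeEntry

variable {w b : ℕ}

/-- The sign of a digit of the modulus; the digits beyond the register are `0` and have the
sign `-1`. -/
theorem encodes_controlled_sign (i : ℕ) :
    Encodes 1 fun _ : Oracles w b => controlled fun c : Fin (b + 1) ⊕ Fin b → Bool =>
      if digit b (Nat.ofBits fun i => c (Sum.inl i)) i then 1 else -1 := by
  by_cases hi : i < b
  · refine (encodes_diagonal_two (d := fun p q => if q then if p then 1 else -1 else 1)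
      (Sum.inl_ne_inr : Sum.inl (Sum.inl (⟨b - 1 - i, by omega⟩ : Fin (b + 1))) ≠ Sum.inr ())
      fun x y => ?_).congr fun _ => ?_
    · cases x <;> cases y <;> simp
    · simp only [controlled, digit, hi, decide_true, Bool.true_and, Function.comp_apply,
        Nat.testBit_ofBits_lt _ _ (show b - 1 - i < b + 1 by omega)]
  · refine (encodes_diagonal_one (d := fun q => if q then -1 else 1) (Sum.inr ())
      fun x => ?_).congr fun _ => ?_
    · cases x <;> simp
    · simp [controlled, digit, hi]

/-- Repeated averaging gives the signs of the digits `j, …, j + r - 1` the weights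
`1 / 2, 1 / 4, …`; the last weight occurs twice, the second time with the constant `-1`. -/
theorem encodes_controlled_signs (r j : ℕ) :
    Encodes (3 * r + 1) fun _ : Oracles w b => controlled fun c : Fin (b + 1) ⊕ Fin b → Bool =>
      (∑ i ∈ Finset.range r,
        (if digit b (Nat.ofBits fun i => c (Sum.inl i)) (j + i) then 1 else -1) * (1 / 2) ^ (i + 1)) -
          (1 / 2) ^ r := by
  induction r generalizing j with
  | zero =>
    refine (encodes_diagonal_one (d := fun q => if q then -1 else 1) (Sum.inr ())
      fun x => ?_).congr fun _ => ?_
    · cases x <;> simp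
    · simp [controlled]
  | succ r ih =>
    refine (((encodes_controlled_sign j).controlled_average (ih (j + 1))).mono (by omega)).congr
      fun _ => ?_
    congr 1
    ext c
    have hsum : ∀ σ : ℕ → ℂ, ∑ i ∈ Finset.range r, σ (j + (i + 1)) * (1 / 2) ^ (i + 1 + 1) =
        (∑ i ∈ Finset.range r, σ (j + 1 + i) * (1 / 2) ^ (i + 1)) / 2 := by
      intro σ
      rw [Finset.sum_div]
      refine Finset.sum_congr rfl fun i _ => ?_
      rw [add_assoc j, add_comm 1 i]
      ring
    rw [Finset.sum_range_succ', add_zero, zero_add, pow_one,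
      hsum fun i => if digit b (Nat.ofBits fun i => c (Sum.inl i)) i then 1 else -1]
    ring

theorem encodes_truncation (m : ℕ) :
    Encodes (3 * m + 3) fun _ : Oracles w b => controlled fun c : Fin (b + 1) ⊕ Fin b → Bool =>
      (truncation b (Nat.ofBits fun i => c (Sum.inl i)) m : ℂ) := by
  have h1 : Encodes 0 fun _ : Oracles w b =>
      controlled fun _ : Fin (b + 1) ⊕ Fin b → Bool => (1 : ℂ) :=
    Encodes.one.congr fun _ => by simp [controlled]
  refine ((h1.controlled_average (encodes_controlled_signs m 0)).mono (by omega)).congr fun _ => ?_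
  congr 1
  ext c
  have h2 : ∀ m, ∑ i ∈ Finset.range m, (1 / 2 : ℂ) ^ (i + 1) = 1 - (1 / 2) ^ m := by
    intro m
    induction m with
    | zero => simp
    | succ m ih => rw [Finset.sum_range_succ, ih]; ring
  have h3 : ∀ δ : ℕ → Bool, ∑ i ∈ Finset.range m, (if δ i then 1 else -1) * (1 / 2 : ℂ) ^ (i + 1) =
      2 * ∑ i ∈ Finset.range m, (if δ i then (1 / 2 : ℂ) ^ (i + 1) else 0) -
        ∑ i ∈ Finset.range m, (1 / 2 : ℂ) ^ (i + 1) := by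
    intro δ
    rw [Finset.mul_sum, ← Finset.sum_sub_distrib]
    refine Finset.sum_congr rfl fun i _ => ?_
    split_ifs <;> ring
  simp only [zero_add]
  rw [h3, h2, truncation]
  push_cast [apply_ite Complex.ofReal]
  ring

theorem encodes_phase (m : ℕ) :
    Encodes m fun _ : Oracles w b => Matrix.diagonal fun c : Fin (b + 1) ⊕ Fin b → Bool =>
      Complex.exp (Complex.I * (2 * Real.pi *
        truncation b (Nat.ofBits fun i => c (Sum.inr i)) m : ℝ)) := by
  induction m with
  | zero => exact Encodes.one.congr fun _ => by simp [truncation]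
  | succ m ih =>
    have h : Encodes 1 fun _ : Oracles w b => Matrix.diagonal fun c : Fin (b + 1) ⊕ Fin b → Bool =>
        Complex.exp (Complex.I * (2 * Real.pi *
          (if digit b (Nat.ofBits fun i => c (Sum.inr i)) m then (1 / 2) ^ (m + 1)
            else 0) : ℝ)) := by
      by_cases hm : m < b
      · refine (encodes_diagonal_one (d := fun q => Complex.exp (Complex.I * (2 * Real.pi *
          (if q then (1 / 2) ^ (m + 1) else 0) : ℝ))) (Sum.inr ⟨b - 1 - m, by omega⟩)
          fun x => Complex.norm_exp_I_mul_ofReal _).congr fun _ => ?_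
        simp only [digit, hm, decide_true, Bool.true_and,
          Nat.testBit_ofBits_lt _ _ (show b - 1 - m < b by omega)]
      · exact (Encodes.one.mono zero_le_one).congr fun _ => by simp [digit, hm]
    refine (ih.mul h).congr fun _ => ?_
    rw [Matrix.diagonal_mul_diagonal]
    congr 1
    ext c
    rw [← Complex.exp_add, ← mul_add, ← Complex.ofReal_add, ← mul_add]
    rw [truncation, truncation, Finset.sum_range_succ]

/-- Multiplication of the amplitude by the approximate value of an entry takes `O(m)` gates, however
many digits the output register has. -/
theorem encodes_approxValue (m : ℕ) :
    Encodes (4 * m + 5) fun _ : Oracles w b =>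
      Matrix.diagonal (approxValue m : (Fin (b + 1) ⊕ Fin b → Bool) → ℂ) := by
  refine ((((encodes_truncation m).clip (Sum.inl (Fin.last b))).mul (encodes_phase m)).mono
    (by omega)).congr fun _ => ?_
  rw [Matrix.diagonal_mul_diagonal]
  congr 1
  ext c
  rw [approxValue]
  split_ifs <;> simp

end EncodeEntry

/-! ### Locations of the nonzero entries -/

section Location

variable {n : ℕ} (A : Matrix (Fin n) (Fin n) ℂ) (i : Fin n)

theorem finite_setOf_entry_ne_zero : {j | ∃ h : j < n, A i ⟨j, h⟩ ≠ 0}.Finite :=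
  (Set.finite_Iio n).subset fun _ hj => hj.1

theorem card_setOf_entry_ne_zero :
    (finite_setOf_entry_ne_zero A i).toFinset.card = rowCount A i := by
  classical
  symm
  refine Finset.card_bij (fun j _ => (j : ℕ)) ?_ ?_ ?_
  · intro j hj
    rw [Set.Finite.mem_toFinset]
    exact ⟨j.2, (Finset.mem_filter.1 hj).2⟩
  · exact fun j _ k _ h => Fin.ext h
  · intro j hj
    rw [Set.Finite.mem_toFinset] at hj
    obtain ⟨h, hj⟩ := hj
    exact ⟨⟨j, h⟩, Finset.mem_filter.2 ⟨Finset.mem_univ _, hj⟩, rfl⟩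

theorem exists_location_eq {l : ℕ} (hl : l < rowCount A i) :
    ∃ j : Fin n, A i j ≠ 0 ∧ location A i l = j := by
  have h : ∃ h : _ < n, A i ⟨_, h⟩ ≠ 0 :=
    Nat.nth_mem l fun hf => (card_setOf_entry_ne_zero A i).symm ▸ hl
  obtain ⟨h, hj⟩ := h
  exact ⟨⟨_, h⟩, hj, if_pos hl⟩

theorem exists_eq_location {j : Fin n} (hj : A i j ≠ 0) :
    ∃ l < rowCount A i, location A i l = j := by
  classical
  have hp : ∃ h : (j : ℕ) < n, A i ⟨j, h⟩ ≠ 0 := ⟨j.2, hj⟩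
  have hl : Nat.count (fun j => ∃ h : j < n, A i ⟨j, h⟩ ≠ 0) j < rowCount A i := by
    rw [← card_setOf_entry_ne_zero A i]
    exact Nat.count_lt_card (finite_setOf_entry_ne_zero A i) hp
  exact ⟨_, hl, (if_pos hl).trans (Nat.nth_count hp)⟩

theorem location_injOn {l l' : ℕ} (hl : l < rowCount A i) (hl' : l' < rowCount A i)
    (h : location A i l = location A i l') : l = l' := by
  rw [location, location, if_pos hl, if_pos hl'] at h
  exact Nat.nth_injOn (finite_setOf_entry_ne_zero A i)
    (Set.mem_Iio.2 ((card_setOf_entry_ne_zero A i).symm ▸ hl))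
    (Set.mem_Iio.2 ((card_setOf_entry_ne_zero A i).symm ▸ hl')) h

/-- The location function enumerates the nonzero entries of a row. -/
theorem sum_range_rowCount {M : Type*} [AddCommMonoid M] (f : ℕ → M)
    [DecidablePred fun j => A i j ≠ 0] :
    ∑ l ∈ Finset.range (rowCount A i), f (location A i l) =
      ∑ j ∈ Finset.univ.filter (fun j => A i j ≠ 0), f j := by
  symm
  choose! g hg hg' using fun j => exists_eq_location A i (j := j)
  refine Finset.sum_bij (fun j _ => g j) (fun j hj => ?_) (fun j hj k hk h => ?_) (fun l hl => ?_)
    fun j hj => ?_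
  · exact Finset.mem_range.2 (hg j (Finset.mem_filter.1 hj).2)
  · rw [Fin.ext_iff, ← hg' j (Finset.mem_filter.1 hj).2, ← hg' k (Finset.mem_filter.1 hk).2, h]
  · rw [Finset.mem_range] at hl
    obtain ⟨j, hj, h⟩ := exists_location_eq A i hl
    exact ⟨j, Finset.mem_filter.2 ⟨Finset.mem_univ _, hj⟩,
      location_injOn A i (hg j hj) hl ((hg' j hj).trans h.symm)⟩
  · rw [hg' j (Finset.mem_filter.1 hj).2]

end Location

/-! ### The registers of one step -/

section Registers

variable {w b : ℕ}

/-- The ancilla wires: a register of `w` qubits, followed by a flag, a qubit that tops up the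
register to `w + 1` qubits, a qubit for the preparation of uniform superpositions, and the output
register of the entry oracle. -/
abbrev Anc (w b : ℕ) : Type := ((Fin w ⊕ Unit) ⊕ (Unit ⊕ Unit)) ⊕ (Fin (b + 1) ⊕ Fin b)

/-- The basis state with `x` in the system register, `y` in the ancilla register, `f` in the flag
and `c` in the output register. -/
def basisState (x y : Fin w → Bool) (f : Bool) (c : Fin (b + 1) ⊕ Fin b → Bool) :
    Fin w ⊕ Anc w b → Bool :=
  Sum.elim x (Sum.elim (Sum.elim (Sum.elim y fun _ => f) fun _ => false) c)

/-- The wires on which a uniform superposition is prepared. -/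
def prepWires : Fin w ⊕ Unit ↪ Fin w ⊕ Anc w b where
  toFun := Sum.elim (fun i => .inr (.inl (.inl (.inl i)))) fun _ => .inr (.inl (.inr (.inr ())))
  inj' := by rintro (i | i) (j | j) h <;> simp_all

/-- The system register and the ancilla register with a top qubit `t`. -/
def locationWires (t : Fin w ⊕ Anc w b) (h1 : ∀ i, Sum.inl i ≠ t)
    (h2 : ∀ i, Sum.inr (.inl (.inl (.inl i))) ≠ t) : Fin w ⊕ Fin (w + 1) ↪ Fin w ⊕ Anc w b where
  toFun := Sum.elim .inl (Fin.snoc (α := fun _ => Fin w ⊕ Anc w b)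
    (fun i => .inr (.inl (.inl (.inl i)))) t)
  inj' := by
    rintro (i | i) (j | j) h
    · simpa using h
    · cases j using Fin.lastCases with
      | last => simp [h1] at h
      | cast j => simp at h
    · cases i using Fin.lastCases with
      | last => simp [(h1 _).symm] at h
      | cast j => simp at h
    · cases i using Fin.lastCases with
      | last => cases j using Fin.lastCases with
        | last => rfl
        | cast j => simp [(h2 _).symm] at h
      | cast i => cases j using Fin.lastCases with
        | last => simp [h2] at h
        | cast j => simpa using h

theorem locationWires_castSucc (t : Fin w ⊕ Anc w b) (h1 : ∀ i, Sum.inl i ≠ t)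
    (h2 : ∀ i, Sum.inr (.inl (.inl (.inl i))) ≠ t) (i : Fin w) :
    locationWires t h1 h2 (.inr i.castSucc) = .inr (.inl (.inl (.inl i))) :=
  Fin.snoc_castSucc (α := fun _ => Fin w ⊕ Anc w b) t (fun i => .inr (.inl (.inl (.inl i)))) i

theorem locationWires_last (t : Fin w ⊕ Anc w b) (h1 : ∀ i, Sum.inl i ≠ t)
    (h2 : ∀ i, Sum.inr (.inl (.inl (.inl i))) ≠ t) :
    locationWires t h1 h2 (.inr (Fin.last w)) = t :=
  Fin.snoc_last (α := fun _ => Fin w ⊕ Anc w b) t fun i => .inr (.inl (.inl (.inl i)))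

/-- The wires of the queries to the column oracle: the top qubit is the flag. -/
def colWires : Fin w ⊕ Fin (w + 1) ↪ Fin w ⊕ Anc w b :=
  locationWires (.inr (.inl (.inl (.inr ())))) (by simp) (by simp)

/-- The wires of the queries to the row oracle: the flag is not among them. -/
def rowWires : Fin w ⊕ Fin (w + 1) ↪ Fin w ⊕ Anc w b :=
  locationWires (.inr (.inl (.inr (.inl ())))) (by simp) (by simp)

/-- The wires of the queries to the entry oracle. -/
def entryWires : (Fin w ⊕ Fin w) ⊕ (Fin (b + 1) ⊕ Fin b) ↪ Fin w ⊕ Anc w b where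
  toFun := Sum.elim (Sum.elim .inl fun i => .inr (.inl (.inl (.inl i)))) fun i => .inr (.inr i)
  inj' := by rintro ((i | i) | i) ((j | j) | j) h <;> simp_all

/-- The output register. -/
def outWires : Fin (b + 1) ⊕ Fin b ↪ Fin w ⊕ Anc w b where
  toFun i := .inr (.inr i)
  inj' i j h := by simpa using h

theorem extend_eq_of_forall {ι κ : Type} {e : κ ↪ ι} {x z : ι → Bool} {y : κ → Bool}
    (h1 : ∀ j, z (e j) = y j) (h2 : ∀ i, i ∉ Set.range e → z i = x i) :
    Function.extend e y x = z := by
  ext i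
  by_cases hi : ∃ j, e j = i
  · obtain ⟨j, rfl⟩ := hi
    rw [e.injective.extend_apply, h1]
  · rw [Function.extend_apply' _ _ _ hi, h2 i hi]

variable (x y y' : Fin w → Bool) (f f' : Bool) (c c' : Fin (b + 1) ⊕ Fin b → Bool)

theorem basisState_comp_prepWires :
    basisState x y f c ∘ prepWires = Sum.elim y fun _ => false := by
  ext (i | i) <;> rfl

theorem extend_prepWires :
    Function.extend prepWires (Sum.elim y' fun _ => false) (basisState x y f c) =
      basisState x y' f c := by
  refine extend_eq_of_forall ?_ ?_
  · rintro (i | i) <;> rfl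
  · rintro (i | ((i | i) | (i | i)) | i) h
    · rfl
    · exact (h ⟨.inl i, rfl⟩).elim
    all_goals rfl

theorem basisState_comp_colWires :
    basisState x y f c ∘ colWires = Sum.elim x (Fin.snoc (α := fun _ => Bool) y f) := by
  ext (i | i)
  · rfl
  · rw [Function.comp_apply, colWires]
    cases i using Fin.lastCases
    · rw [locationWires_last, Sum.elim_inr, Fin.snoc_last]
      rfl
    · rw [locationWires_castSucc, Sum.elim_inr, Fin.snoc_castSucc]
      rfl

theorem extend_colWires :
    Function.extend colWires (Sum.elim x (Fin.snoc (α := fun _ => Bool) y' f'))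
      (basisState x y f c) = basisState x y' f' c := by
  refine extend_eq_of_forall (fun j => ?_) ?_
  · rw [← basisState_comp_colWires x y' f' c]
    rfl
  · rintro (i | ((i | i) | (i | i)) | i) h
    · rfl
    · exact (h ⟨.inr i.castSucc, locationWires_castSucc _ _ _ _⟩).elim
    · exact (h ⟨.inr (Fin.last w), locationWires_last _ _ _⟩).elim
    all_goals rfl

theorem basisState_comp_rowWires :
    basisState x y f c ∘ rowWires = Sum.elim x (Fin.snoc (α := fun _ => Bool) y false) := by
  ext (i | i)
  · rfl
  · rw [Function.comp_apply, rowWires]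
    cases i using Fin.lastCases
    · rw [locationWires_last, Sum.elim_inr, Fin.snoc_last]
      rfl
    · rw [locationWires_castSucc, Sum.elim_inr, Fin.snoc_castSucc]
      rfl

theorem extend_rowWires :
    Function.extend rowWires (Sum.elim x (Fin.snoc (α := fun _ => Bool) y' false))
      (basisState x y f c) = basisState x y' f c := by
  refine extend_eq_of_forall (fun j => ?_) ?_
  · rw [← basisState_comp_rowWires x y' f c]
    rfl
  · rintro (i | ((i | i) | (i | i)) | i) h
    · rfl
    · exact (h ⟨.inr i.castSucc, locationWires_castSucc _ _ _ _⟩).elim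
    all_goals rfl

theorem basisState_comp_entryWires :
    basisState x y f c ∘ entryWires = Sum.elim (Sum.elim x y) c := by
  ext ((i | i) | i) <;> rfl

theorem extend_entryWires :
    Function.extend entryWires (Sum.elim (Sum.elim x y) c') (basisState x y f c) =
      basisState x y f c' := by
  refine extend_eq_of_forall ?_ ?_
  · rintro ((i | i) | i) <;> rfl
  · rintro (i | ((i | i) | (i | i)) | i) h
    · rfl
    · rfl
    · rfl
    · rfl
    · rfl
    · exact (h ⟨.inr i, rfl⟩).elim

theorem flag_notMem_range_rowWires :
    (.inr (.inl (.inl (.inr ()))) : Fin w ⊕ Anc w b) ∉ Set.range rowWires := by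
  rintro ⟨i | i, h⟩
  · cases h
  · rw [rowWires] at h
    cases i using Fin.lastCases
    · rw [locationWires_last] at h
      simp at h
    · rw [locationWires_castSucc] at h
      simp at h

theorem flag_notMem_range_entryWires :
    (.inr (.inl (.inl (.inr ()))) : Fin w ⊕ Anc w b) ∉ Set.range entryWires := by
  rintro ⟨(i | i) | i, h⟩ <;> cases h

/-- Swapping the system register with the ancilla register. -/
theorem exists_encodes_swap_registers (T : Finset (Fin w)) :
    ∃ U : Matrix (Fin w ⊕ Anc w b → Bool) (Fin w ⊕ Anc w b → Bool) ℂ,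
      Encodes T.card (fun _ : Oracles w b => U) ∧
      ∀ x y f c, U *ᵥ ket (basisState x y f c) =
        ket (basisState (T.piecewise y x) (T.piecewise x y) f c) := by
  induction T using Finset.induction_on with
  | empty => exact ⟨1, Encodes.one, fun x y f c => by simp⟩
  | insert q T hq ih =>
    obtain ⟨U, hU, hU1⟩ := ih
    obtain ⟨V, hV, hV1⟩ := exists_encodes_swap (w := w) (b := b)
      (Sum.inl_ne_inr : Sum.inl q ≠ (Sum.inr (.inl (.inl (.inl q))) : Fin w ⊕ Anc w b))
    refine ⟨V * U, (hV.mul hU).mono (by rw [Finset.card_insert_of_notMem hq, add_comm]),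
      fun x y f c => ?_⟩
    rw [← Matrix.mulVec_mulVec, hU1, hV1]
    congr 1
    ext i
    rw [Function.comp_apply (g := Equiv.swap _ _), Equiv.swap_apply_def]
    rcases i with i | ((i | i) | (i | i)) | i
    · by_cases hi : i = q
      · subst hi
        simp [basisState, hq]
      · simp [basisState, hi, Finset.piecewise_insert_of_ne _ _ _ hi]
    · by_cases hi : i = q
      · subst hi
        simp [basisState, hq]
      · simp [basisState, hi, Finset.piecewise_insert_of_ne _ _ _ hi]
    all_goals simp [basisState]

end Registers

/-! ### One step: a block encoding of the matrix divided by its sparsity -/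

section Step

variable {n b s : ℕ} {A : Matrix (Fin n) (Fin n) ℂ} {τ : ℝ} {O : Oracles (numQubits n) b}

theorem bits_succ (w v : ℕ) :
    bits (w + 1) v = Fin.snoc (α := fun _ => Bool) (bits w v) (v.testBit w) := by
  ext i
  cases i using Fin.lastCases
  · rw [Fin.snoc_last]
    simp [bits]
  · rw [Fin.snoc_castSucc]
    rfl

theorem le_two_pow_numQubits (n : ℕ) : n ≤ 2 ^ numQubits n := Nat.le_pow_clog one_lt_two n

theorem bits_succ_of_lt {v : ℕ} (hv : v < n) : bits (numQubits n + 1) v =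
    Fin.snoc (α := fun _ => Bool) (bits (numQubits n) v) false := by
  rw [bits_succ, Nat.testBit_lt_two_pow (hv.trans_le (le_two_pow_numQubits n))]

theorem conjTranspose_mulVec_of_mulVec_eq {ι κ : Type} [Fintype ι] [DecidableEq ι] [Fintype κ]
    [DecidableEq κ] {e : κ ↪ ι} {G : Matrix.unitaryGroup (κ → Bool) ℂ} {u v : (ι → Bool) → ℂ}
    (h : onWires e G.1 *ᵥ u = v) : (onWires e G.1)ᴴ *ᵥ v = u := by
  rw [← h, Matrix.mulVec_mulVec, ← onWires_conjTranspose, ← onWires_mul,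
    ← Matrix.star_eq_conjTranspose, Matrix.UnitaryGroup.star_mul_self, onWires_one,
    Matrix.one_mulVec]

/-- All registers but the system register and the ancilla register are in the state `|0⟩`. -/
abbrev indexState (n b x y : ℕ) : Fin (numQubits n) ⊕ Anc (numQubits n) b → Bool :=
  basisState (bits _ x) (bits _ y) false fun _ => false

theorem col_mulVec_ket (hO : IsLocationOracle Aᵀ s O.col) (hsn : s ≤ n) (j : Fin n) {l : ℕ}
    (hl : l < s) : onWires colWires O.col.1 *ᵥ ket (indexState n b j l) =
      ket (basisState (bits _ j) (bits _ (location Aᵀ j l))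
        ((location Aᵀ j l).testBit (numQubits n)) fun _ => false) := by
  refine onWires_mulVec_ket_of_eq_ket (y := Sum.elim (bits _ j) (bits _ (location Aᵀ j l))) ?_ ?_
  · rw [basisState_comp_colWires, ← bits_succ_of_lt (hl.trans_le hsn)]
    exact hO j l hl
  · rw [bits_succ, extend_colWires]

theorem row_mulVec_ket (hO : IsLocationOracle A s O.row) (hsn : s ≤ n) (i j : Fin n) {l : ℕ}
    (hl : l < s) (h : location A i l = j) :
    onWires rowWires O.row.1 *ᵥ ket (indexState n b i l) = ket (indexState n b i j) := by
  refine onWires_mulVec_ket_of_eq_ket (y := Sum.elim (bits _ i) (bits _ j)) ?_ ?_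
  · rw [basisState_comp_rowWires, ← bits_succ_of_lt (hl.trans_le hsn), ← h]
    exact hO i l hl
  · rw [bits_succ_of_lt j.2, extend_rowWires]

theorem entry_mulVec_ket {c : Fin (b + 1) ⊕ Fin b → Bool} {i j : Fin n}
    (hc : O.entry.1 *ᵥ ket (Sum.elim (Sum.elim (bits (numQubits n) i) (bits (numQubits n) j))
        (fun _ => false)) =
      ket (Sum.elim (Sum.elim (bits (numQubits n) i) (bits (numQubits n) j)) c)) :
    onWires entryWires O.entry.1 *ᵥ ket (indexState n b i j) =
      ket (basisState (bits _ i) (bits _ j) false c) := by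
  refine onWires_mulVec_ket_of_eq_ket ?_ (extend_entryWires _ _ _ _ _)
  rw [basisState_comp_entryWires, hc]

/-- The operations between the preparation of the superposition over `l` and its inverse: the column
oracle turns `|j⟩|l⟩` into `|j⟩|i⟩`, the registers are swapped, the entry oracle is queried and
inverted, in between the amplitude is multiplied by the value of the entry, and the inverse of the
row oracle turns `|i⟩|j⟩` into `|i⟩|l'⟩`. -/
def core (m : ℕ) (W : Matrix (Fin (numQubits n) ⊕ Anc (numQubits n) b → Bool)
      (Fin (numQubits n) ⊕ Anc (numQubits n) b → Bool) ℂ) (O : Oracles (numQubits n) b) :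
    Matrix (Fin (numQubits n) ⊕ Anc (numQubits n) b → Bool)
      (Fin (numQubits n) ⊕ Anc (numQubits n) b → Bool) ℂ :=
  (onWires rowWires O.row.1)ᴴ * ((onWires entryWires O.entry.1)ᴴ *
    (onWires outWires (Matrix.diagonal (approxValue m)) * (onWires entryWires O.entry.1 *
      (W * onWires colWires O.col.1))))

theorem encodes_core (m : ℕ) {t : ℕ}
    {W : Matrix (Fin (numQubits n) ⊕ Anc (numQubits n) b → Bool)
      (Fin (numQubits n) ⊕ Anc (numQubits n) b → Bool) ℂ}
    (hW : Encodes t fun _ : Oracles (numQubits n) b => W) :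
    Encodes (4 * m + t + 9) (core m W) := by
  have hrow : Encodes 1 fun O : Oracles (numQubits n) b =>
      onWires (rowWires (b := b)) O.row.1 := (Encodes.of_step (.row false _)).congr fun _ => rfl
  have hcol : Encodes 1 fun O : Oracles (numQubits n) b =>
      onWires (colWires (b := b)) O.col.1 := (Encodes.of_step (.col false _)).congr fun _ => rfl
  have hentry : Encodes 1 fun O : Oracles (numQubits n) b =>
      onWires entryWires O.entry.1 := (Encodes.of_step (.entry false _)).congr fun _ => rfl
  exact (hrow.conjTranspose.mul (hentry.conjTranspose.mul
    (((encodes_approxValue m).onWires outWires).mul (hentry.mul (hW.mul hcol))))).mono (by omega)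

variable {m : ℕ} {W : Matrix (Fin (numQubits n) ⊕ Anc (numQubits n) b → Bool)
      (Fin (numQubits n) ⊕ Anc (numQubits n) b → Bool) ℂ}

theorem core_mulVec_ket (hA : IsSparse A s) (hsn : s ≤ n) (hO : IsSparseAccess A s τ O)
    (hW : ∀ x y f c, W *ᵥ ket (basisState x y f c) = ket (basisState y x f c))
    {c : Fin (b + 1) ⊕ Fin b → Bool} {i j : Fin n} {l : ℕ} (hl : l < rowCount Aᵀ j)
    (hi : location Aᵀ j l = i) (hij : A i j ≠ 0)
    (hc : O.entry.1 *ᵥ ket (Sum.elim (Sum.elim (bits (numQubits n) i) (bits (numQubits n) j))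
        (fun _ => false)) =
      ket (Sum.elim (Sum.elim (bits (numQubits n) i) (bits (numQubits n) j)) c)) :
    ∃ l' < s, core m W O *ᵥ ket (indexState n b j l) =
      approxValue m c • ket (indexState n b i l') := by
  obtain ⟨l', hl', hj⟩ := exists_eq_location A i hij
  refine ⟨l', hl'.trans_le (hA.1 i), ?_⟩
  have hentry := entry_mulVec_ket hc
  have hflag : ((i : ℕ).testBit (numQubits n)) = false :=
    Nat.testBit_lt_two_pow (i.2.trans_le (le_two_pow_numQubits n))
  rw [core, ← Matrix.mulVec_mulVec, ← Matrix.mulVec_mulVec, ← Matrix.mulVec_mulVec,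
    ← Matrix.mulVec_mulVec, ← Matrix.mulVec_mulVec,
    col_mulVec_ket hO.col hsn j (hl.trans_le (hA.2 j)), hi, hflag, hW, hentry, onWires_diagonal,
    diagonal_mulVec_ket, Matrix.mulVec_smul, conjTranspose_mulVec_of_mulVec_eq hentry,
    Matrix.mulVec_smul, conjTranspose_mulVec_of_mulVec_eq
      (row_mulVec_ket hO.row hsn i j (hl'.trans_le (hA.1 i)) hj)]
  rfl

/-- Where the column has no further nonzero entry, the column oracle sets the flag, which is not
touched any more. -/
theorem core_mulVec_ket_apply_of_flag (hsn : s ≤ n)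
    (hO : IsSparseAccess A s τ O)
    (hW : ∀ x y f c, W *ᵥ ket (basisState x y f c) = ket (basisState y x f c))
    {j : Fin n} {l : ℕ} (hl : rowCount Aᵀ j ≤ l) (hls : l < s)
    (z : Fin (numQubits n) ⊕ Anc (numQubits n) b → Bool)
    (hz : z (.inr (.inl (.inl (.inr ())))) = false) :
    (core m W O *ᵥ ket (indexState n b j l)) z = 0 := by
  have hflag : ((location Aᵀ j l).testBit (numQubits n)) = true := by
    rw [location, if_neg hl.not_gt, add_comm, Nat.testBit_two_pow_add_eq,
      Nat.testBit_lt_two_pow ((hls.trans_le hsn).trans_le (le_two_pow_numQubits n))]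
    rfl
  rw [core, ← Matrix.mulVec_mulVec, ← Matrix.mulVec_mulVec, ← Matrix.mulVec_mulVec,
    ← Matrix.mulVec_mulVec, ← Matrix.mulVec_mulVec, col_mulVec_ket hO.col hsn j hls, hflag, hW,
    ← onWires_conjTranspose, ← onWires_conjTranspose]
  refine onWires_mulVec_eq_zero _ flag_notMem_range_rowWires (fun z hz => ?_) z hz
  refine onWires_mulVec_eq_zero _ flag_notMem_range_entryWires (fun z hz => ?_) z hz
  refine onWires_mulVec_eq_zero _ (by rintro ⟨i, hi⟩; cases hi) (fun z hz => ?_) z hz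
  refine onWires_mulVec_eq_zero _ flag_notMem_range_entryWires (fun z hz => ?_) z hz
  refine ket_of_ne ?_
  rintro rfl
  cases hz

theorem basisState_inj {w : ℕ} {x x' y y' : Fin w → Bool} {f f' : Bool}
    {c c' : Fin (b + 1) ⊕ Fin b → Bool} :
    basisState x y f c = basisState x' y' f' c' ↔ x = x' ∧ y = y' ∧ f = f' ∧ c = c' := by
  rw [basisState, basisState, Sum.elim_eq_iff, Sum.elim_eq_iff, Sum.elim_eq_iff, sumElim_unit_inj]
  tauto

/-- The oracles turn into a block encoding of the matrix, divided by its sparsity and with entries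
replaced by their approximate values. -/
theorem exists_encodes_step (n s m b : ℕ) (hs : 1 ≤ s) (hsn : s ≤ n) :
    ∃ B : Oracles (numQubits n) b →
        Matrix (Fin (numQubits n) → Bool) (Fin (numQubits n) → Bool) ℂ,
      Encodes (3 * numQubits n + 4 * m + 11) B ∧
      ∀ (A : Matrix (Fin n) (Fin n) ℂ) (τ : ℝ) (O : Oracles (numQubits n) b), IsSparse A s →
        IsSparseAccess A s τ O → ∀ c : Fin n → Fin n → Fin (b + 1) ⊕ Fin b → Bool,
        (∀ i j : Fin n, O.entry.1 *ᵥ ket (Sum.elim (Sum.elim (bits (numQubits n) i)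
            (bits (numQubits n) j)) (fun _ => false)) =
          ket (Sum.elim (Sum.elim (bits (numQubits n) i) (bits (numQubits n) j)) (c i j))) →
        ∀ j : Fin n, B O *ᵥ ket (bits (numQubits n) j) = (s : ℂ)⁻¹ •
          ∑ i, (if A i j = 0 then 0 else approxValue m (c i j)) • ket (bits (numQubits n) i) := by
  have hs0 : (√s : ℂ) ≠ 0 := by
    rw [Ne, Complex.ofReal_eq_zero, Real.sqrt_eq_zero (Nat.cast_nonneg s)]
    exact Nat.cast_ne_zero.2 (by omega)
  obtain ⟨P, hP, hP0, -⟩ := exists_encodes_uniform (w := numQubits n) (b := b) (numQubits n) s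
    (hsn.trans (le_two_pow_numQubits n))
  obtain ⟨W, hW, hW1⟩ := exists_encodes_swap_registers (w := numQubits n) (b := b) Finset.univ
  simp only [Finset.piecewise_univ] at hW1
  set V := onWires (prepWires (w := numQubits n) (b := b)) P with hV
  have hV0 : ∀ x, V *ᵥ ket (basisState x (bits _ 0) false fun _ => false) =
      (√s : ℂ)⁻¹ • ∑ l ∈ Finset.range s,
        ket (basisState x (bits _ l) false fun _ => false) := by
    intro x
    rw [eq_inv_smul_iff₀ hs0, hV, onWires_mulVec_ket, basisState_comp_prepWires, ← map_smul]
    refine (congrArg _ hP0).trans ?_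
    rw [map_sum]
    refine Finset.sum_congr rfl fun l _ => ?_
    rw [lift_ket, numState, extend_prepWires]
  refine ⟨fun O => block (Vᴴ * (core m W O * V)), ?_, ?_⟩
  · refine ((hP.onWires prepWires).conjTranspose.mul
      ((encodes_core m hW).mul (hP.onWires prepWires))).block.mono ?_
    rw [Finset.card_univ, Fintype.card_fin]
    omega
  intro A τ O hA hO c hc j
  ext x
  rw [mulVec_ket_apply]
  simp only [block, Matrix.of_apply]
  have hst : ∀ x : Fin (numQubits n) → Bool,
      (Sum.elim x fun _ => false : Fin (numQubits n) ⊕ Anc (numQubits n) b → Bool) =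
        basisState x (bits _ 0) false fun _ => false := by
    intro x
    ext (i | ((i | i) | (i | i)) | i) <;> simp [basisState, bits_zero]
  rw [hst, hst, ← mulVec_ket_apply (Vᴴ * (core m W O * V)), ← Matrix.mulVec_mulVec,
    ← Matrix.mulVec_mulVec, hV0]
  have hVstar : ∀ ψ : (Fin (numQubits n) ⊕ Anc (numQubits n) b → Bool) → ℂ,
      (Vᴴ *ᵥ ψ) (basisState x (bits _ 0) false fun _ => false) =
        (√s : ℂ)⁻¹ * ∑ l ∈ Finset.range s, ψ (basisState x (bits _ l) false fun _ => false) := by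
    intro ψ
    have h : ∀ z, Vᴴ (basisState x (bits _ 0) false fun _ => false) z =
        star ((V *ᵥ ket (basisState x (bits _ 0) false fun _ => false)) z) := by
      intro z
      rw [mulVec_ket_apply, Matrix.conjTranspose_apply]
    rw [Matrix.mulVec, dotProduct]
    simp only [h, hV0]
    have hstar : star (√s : ℂ)⁻¹ = (√s : ℂ)⁻¹ := by
      rw [← starRingEnd_apply, map_inv₀, Complex.conj_ofReal]
    simp only [Pi.smul_apply, smul_eq_mul, star_mul, hstar, Finset.sum_apply, star_sum,
      Finset.sum_mul]
    rw [Finset.sum_comm, Finset.mul_sum]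
    refine Finset.sum_congr rfl fun l _ => ?_
    rw [← sum_star_ket_mul _ ψ, Finset.mul_sum]
    refine Finset.sum_congr rfl fun z _ => ?_
    ring
  set g : ℕ → ℂ := fun v =>
    if h : v < n then approxValue m (c ⟨v, h⟩ j) * ket (bits (numQubits n) v) x else 0 with hg
  have hcol : ∀ l ∈ Finset.range s, ∑ l' ∈ Finset.range s, (core m W O *ᵥ ket (indexState n b j l))
      (basisState x (bits _ l') false fun _ => false) =
        if l ∈ Finset.range (rowCount Aᵀ j) then g (location Aᵀ j l) else 0 := by
    intro l hls
    rw [Finset.mem_range] at hls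
    split_ifs with hl
    · rw [Finset.mem_range] at hl
      obtain ⟨i, hij, hi⟩ := exists_location_eq Aᵀ j hl
      obtain ⟨l₀, hl₀, h⟩ := core_mulVec_ket (m := m) hA hsn hO hW1 hl hi hij (hc i j)
      have hw : ∀ l < s, l < 2 ^ numQubits n := fun l hl =>
        (hl.trans_le hsn).trans_le (le_two_pow_numQubits n)
      rw [h, hi, Finset.sum_eq_single_of_mem l₀ (Finset.mem_range.2 hl₀)]
      · simp only [hg, i.2, dif_pos, Pi.smul_apply, smul_eq_mul, ket_apply, basisState_inj,
          and_true]
      · intro l' hl' hne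
        rw [Pi.smul_apply, ket_of_ne, smul_zero]
        rw [Ne, basisState_inj]
        exact fun h => hne (bits_injOn (hw _ (Finset.mem_range.1 hl')) (hw _ hl₀) h.2.1)
    · rw [Finset.mem_range, not_lt] at hl
      exact Finset.sum_eq_zero fun l' _ =>
        core_mulVec_ket_apply_of_flag hsn hO hW1 hl hls _ rfl
  have hsub : Finset.range (rowCount Aᵀ j) ⊆ Finset.range s :=
    Finset.range_subset_range.2 (hA.2 j)
  rw [hVstar, Matrix.mulVec_smul, Matrix.mulVec_sum]
  simp only [Pi.smul_apply, Finset.sum_apply, smul_eq_mul, ← Finset.mul_sum]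
  rw [Finset.sum_comm, Finset.sum_congr rfl hcol, Finset.sum_ite_mem,
    Finset.inter_eq_right.2 hsub, ← mul_assoc, ← mul_inv, ← Complex.ofReal_mul,
    Real.mul_self_sqrt (Nat.cast_nonneg s), Complex.ofReal_natCast]
  classical
  rw [sum_range_rowCount, Finset.sum_filter]
  refine congrArg _ (Finset.sum_congr rfl fun i _ => ?_)
  simp only [hg, Fin.is_lt, dif_pos, Matrix.transpose_apply, ite_not, ite_mul, zero_mul]

end Step

/-! ### Norm bounds -/

section Norm

variable {n s : ℕ}

/-- Schur's test: an `s`-sparse matrix with entries of modulus at most `δ` has operator norm at most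
`s * δ`. -/
theorem norm_mulVec_le_of_isSparse {A M : Matrix (Fin n) (Fin n) ℂ} (hA : IsSparse A s)
    (hM : ∀ i j, A i j = 0 → M i j = 0) {δ : ℝ} (hδ : 0 ≤ δ) (hMδ : ∀ i j, ‖M i j‖ ≤ δ)
    (x : EuclideanSpace ℂ (Fin n)) :
    ‖(WithLp.toLp 2 (M *ᵥ x.ofLp) : EuclideanSpace ℂ (Fin n))‖ ≤ s * δ * ‖x‖ := by
  classical
  have hrow : ∀ i, ‖(M *ᵥ x.ofLp) i‖ ^ 2 ≤ s * δ ^ 2 * ∑ j, if A i j ≠ 0 then ‖x j‖ ^ 2 else 0 := by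
    intro i
    have h1 : ‖(M *ᵥ x.ofLp) i‖ ≤ ∑ j ∈ Finset.univ.filter (fun j => A i j ≠ 0), δ * ‖x j‖ := by
      rw [Matrix.mulVec, dotProduct, ← Finset.sum_filter_of_ne (p := fun j => A i j ≠ 0)]
      · refine (norm_sum_le _ _).trans (Finset.sum_le_sum fun j _ => ?_)
        rw [norm_mul]
        exact mul_le_mul_of_nonneg_right (hMδ i j) (norm_nonneg _)
      · intro j _ hj h0
        exact hj (by rw [hM i j h0, zero_mul])
    have h2 : ((Finset.univ.filter fun j => A i j ≠ 0).card : ℝ) ≤ s := by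
      refine Nat.cast_le.2 (le_trans (le_of_eq ?_) (hA.1 i))
      rw [rowCount]
    calc ‖(M *ᵥ x.ofLp) i‖ ^ 2
        ≤ (∑ j ∈ Finset.univ.filter (fun j => A i j ≠ 0), δ * ‖x j‖) ^ 2 :=
          pow_le_pow_left₀ (norm_nonneg _) h1 2
      _ ≤ (Finset.univ.filter fun j => A i j ≠ 0).card *
          ∑ j ∈ Finset.univ.filter (fun j => A i j ≠ 0), (δ * ‖x j‖) ^ 2 :=
          sq_sum_le_card_mul_sum_sq
      _ ≤ s * ∑ j ∈ Finset.univ.filter (fun j => A i j ≠ 0), (δ * ‖x j‖) ^ 2 :=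
          mul_le_mul_of_nonneg_right h2 (Finset.sum_nonneg fun _ _ => sq_nonneg _)
      _ = _ := by
          simp only [mul_pow, ← Finset.mul_sum]
          rw [Finset.sum_filter, mul_assoc]
  have hcol : ∀ j, ∑ i, (if A i j ≠ 0 then ‖x j‖ ^ 2 else 0) ≤ s * ‖x j‖ ^ 2 := by
    intro j
    rw [← Finset.sum_filter, Finset.sum_const, nsmul_eq_mul]
    refine mul_le_mul_of_nonneg_right (Nat.cast_le.2 (le_trans (le_of_eq ?_) (hA.2 j)))
      (sq_nonneg _)
    rw [rowCount]
    congr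
  refine le_of_sq_le_sq ?_ (by positivity)
  rw [EuclideanSpace.norm_sq_eq]
  calc ∑ i, ‖(M *ᵥ x.ofLp) i‖ ^ 2
      ≤ ∑ i, s * δ ^ 2 * ∑ j, (if A i j ≠ 0 then ‖x j‖ ^ 2 else 0) :=
        Finset.sum_le_sum fun i _ => hrow i
    _ = s * δ ^ 2 * ∑ j, ∑ i, (if A i j ≠ 0 then ‖x j‖ ^ 2 else 0) := by
        rw [← Finset.mul_sum, Finset.sum_comm]
    _ ≤ s * δ ^ 2 * ∑ j, s * ‖x j‖ ^ 2 :=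
        mul_le_mul_of_nonneg_left (Finset.sum_le_sum fun j _ => hcol j) (by positivity)
    _ = (s * δ * ‖x‖) ^ 2 := by
        rw [← Finset.mul_sum, ← EuclideanSpace.norm_sq_eq]
        ring

/-- Powers of contractions: the errors of the factors add up. -/
theorem norm_pow_mulVec_sub_le {M N : Matrix (Fin n) (Fin n) ℂ} {δ : ℝ} (hδ : 0 ≤ δ)
    (hM : ∀ x : EuclideanSpace ℂ (Fin n),
      ‖(WithLp.toLp 2 (M *ᵥ x.ofLp) : EuclideanSpace ℂ (Fin n))‖ ≤ ‖x‖)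
    (hN : ∀ x : EuclideanSpace ℂ (Fin n),
      ‖(WithLp.toLp 2 (N *ᵥ x.ofLp) : EuclideanSpace ℂ (Fin n))‖ ≤ ‖x‖)
    (hMN : ∀ x : EuclideanSpace ℂ (Fin n),
      ‖(WithLp.toLp 2 ((M - N) *ᵥ x.ofLp) : EuclideanSpace ℂ (Fin n))‖ ≤ δ * ‖x‖)
    (k : ℕ) (x : EuclideanSpace ℂ (Fin n)) :
    ‖(WithLp.toLp 2 (M ^ k *ᵥ x.ofLp - N ^ k *ᵥ x.ofLp) : EuclideanSpace ℂ (Fin n))‖ ≤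
      k * δ * ‖x‖ := by
  induction k with
  | zero => simp
  | succ k ih =>
    have hNk : ‖(WithLp.toLp 2 (N ^ k *ᵥ x.ofLp) : EuclideanSpace ℂ (Fin n))‖ ≤ ‖x‖ := by
      clear ih
      induction k with
      | zero => simp
      | succ k ih =>
        rw [pow_succ', ← Matrix.mulVec_mulVec]
        exact (hN (WithLp.toLp 2 (N ^ k *ᵥ x.ofLp))).trans ih
    have h : M ^ (k + 1) *ᵥ x.ofLp - N ^ (k + 1) *ᵥ x.ofLp =
        M *ᵥ (M ^ k *ᵥ x.ofLp - N ^ k *ᵥ x.ofLp) + (M - N) *ᵥ (N ^ k *ᵥ x.ofLp) := by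
      rw [Matrix.mulVec_sub, Matrix.sub_mulVec, pow_succ', pow_succ', ← Matrix.mulVec_mulVec,
        ← Matrix.mulVec_mulVec]
      abel
    rw [h, WithLp.toLp_add]
    calc _ ≤ _ := norm_add_le _ _
      _ ≤ k * δ * ‖x‖ + δ * ‖x‖ := add_le_add
          ((hM (WithLp.toLp 2 (M ^ k *ᵥ x.ofLp - N ^ k *ᵥ x.ofLp))).trans ih)
          ((hMN (WithLp.toLp 2 (N ^ k *ᵥ x.ofLp))).trans (mul_le_mul_of_nonneg_left hNk hδ))
      _ = _ := by push_cast; ring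

theorem bits_injective_fin (n : ℕ) :
    Function.Injective fun i : Fin n => bits (numQubits n) i := fun i j h =>
  Fin.ext (bits_injOn (i.2.trans_le (le_two_pow_numQubits n))
    (j.2.trans_le (le_two_pow_numQubits n)) h)

theorem norm_amplitudes (x : EuclideanSpace ℂ (Fin n)) : ‖amplitudes x‖ = ‖x‖ := by
  classical
  rw [← sq_eq_sq₀ (norm_nonneg _) (norm_nonneg _), EuclideanSpace.norm_sq_eq,
    EuclideanSpace.norm_sq_eq]
  symm
  refine Finset.sum_of_injOn (fun i : Fin n => bits (numQubits n) i)
    (bits_injective_fin n).injOn (by simp) ?_ ?_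
  · intro z _ hz
    have : amplitudes x z = 0 := by
      rw [amplitudes, PiLp.toLp_apply, Finset.sum_apply]
      refine Finset.sum_eq_zero fun i _ => ?_
      rw [Pi.smul_apply, ket_of_ne, smul_zero]
      rintro rfl
      exact hz ⟨i, by simp, rfl⟩
    rw [this, norm_zero, zero_pow two_ne_zero]
  · intro i _
    have : amplitudes x (bits (numQubits n) i) = x i := by
      rw [amplitudes, PiLp.toLp_apply, Finset.sum_apply, Finset.sum_eq_single i]
      · rw [Pi.smul_apply, ket_self, smul_eq_mul, mul_one]
      · intro j _ hj
        rw [Pi.smul_apply, ket_of_ne fun h => hj (bits_injective_fin n h).symm, smul_zero]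
      · simp
    rw [this]

theorem amplitudes_sub (x y : EuclideanSpace ℂ (Fin n)) :
    amplitudes x - amplitudes y = amplitudes (x - y) := by
  rw [amplitudes, amplitudes, amplitudes, ← WithLp.toLp_sub, ← Finset.sum_sub_distrib]
  simp only [PiLp.sub_apply, sub_smul]

theorem mulVec_amplitudes {B : Matrix (Fin (numQubits n) → Bool) (Fin (numQubits n) → Bool) ℂ}
    {M : Matrix (Fin n) (Fin n) ℂ}
    (h : ∀ j : Fin n, B *ᵥ ket (bits (numQubits n) j) =
      ∑ i, M i j • ket (bits (numQubits n) i)) (x : EuclideanSpace ℂ (Fin n)) :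
    B *ᵥ (amplitudes x).ofLp = (amplitudes (WithLp.toLp 2 (M *ᵥ x.ofLp))).ofLp := by
  simp only [amplitudes, Matrix.mulVec_sum, Matrix.mulVec_smul, h, Finset.smul_sum, smul_smul]
  rw [Finset.sum_comm]
  refine Finset.sum_congr rfl fun i _ => ?_
  rw [Matrix.mulVec, dotProduct, Finset.sum_smul]
  refine Finset.sum_congr rfl fun j _ => ?_
  rw [mul_comm]

theorem pow_mulVec_amplitudes {B : Matrix (Fin (numQubits n) → Bool) (Fin (numQubits n) → Bool) ℂ}
    {M : Matrix (Fin n) (Fin n) ℂ}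
    (h : ∀ j : Fin n, B *ᵥ ket (bits (numQubits n) j) =
      ∑ i, M i j • ket (bits (numQubits n) i)) (k : ℕ) (x : EuclideanSpace ℂ (Fin n)) :
    B ^ k *ᵥ (amplitudes x).ofLp = (amplitudes (WithLp.toLp 2 (M ^ k *ᵥ x.ofLp))).ofLp := by
  induction k with
  | zero => simp
  | succ k ih =>
    rw [pow_succ', pow_succ', ← Matrix.mulVec_mulVec, ih, mulVec_amplitudes h,
      Matrix.mulVec_mulVec]

end Norm

section BlockEncoding

variable {n a : ℕ}

/-- The definition of a block encoding by states, in terms of the `|0⟩⟨0|`-block of the operator. -/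
theorem isApproxBlockEncoding_of_block
    {U : Matrix (Fin (numQubits n) ⊕ Fin a → Bool) (Fin (numQubits n) ⊕ Fin a → Bool) ℂ}
    {B : Matrix (Fin n) (Fin n) ℂ} {ε : ℝ}
    (h : ∀ x : EuclideanSpace ℂ (Fin n), ‖x‖ = 1 →
      ‖(WithLp.toLp 2 (block U *ᵥ (amplitudes x).ofLp) :
          EuclideanSpace ℂ (Fin (numQubits n) → Bool)) -
        amplitudes (WithLp.toLp 2 (B *ᵥ x.ofLp))‖ ≤ ε) :
    IsApproxBlockEncoding U B ε := by
  intro x hx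
  set ψ := U *ᵥ tensor (ket fun _ => false) (amplitudes x).ofLp with hψ
  refine ⟨_, fun j z => ψ (Sum.elim z j), h x hx, ?_⟩
  have h0 : ∀ z : Fin (numQubits n) → Bool, (block U *ᵥ (amplitudes x).ofLp) z =
      ψ (Sum.elim z fun _ => false) := by
    intro z
    rw [hψ, Matrix.mulVec, Matrix.mulVec, dotProduct, dotProduct, sum_elim_false_right]
    · refine Finset.sum_congr rfl fun y _ => ?_
      simp only [tensor, Sum.elim_inr, Sum.elim_inl, ket_self, one_mul, block, Matrix.of_apply]
    · intro y hy r
      by_contra hr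
      refine hy ?_
      rw [tensor, ket_of_ne, zero_mul, mul_zero]
      intro h
      exact hr (congrFun h r)
  ext z
  rw [Pi.add_apply, Finset.sum_apply]
  simp only [tensor, h0]
  have hz : ψ z = ψ (Sum.elim (fun i => z (Sum.inl i)) fun i => z (Sum.inr i)) := by
    congr 1
    ext (i | i) <;> rfl
  by_cases hzero : (fun i => z (Sum.inr i)) = fun _ : Fin a => false
  · rw [Finset.sum_eq_zero, add_zero, hz, hzero, ket_self, one_mul]
    intro j hj
    rw [hzero, ket_of_ne (Finset.mem_filter.1 hj).2.symm, zero_mul]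
  · rw [ket_of_ne hzero, zero_mul, zero_add,
      Finset.sum_eq_single_of_mem (fun i => z (Sum.inr i)), ket_self, one_mul, hz]
    · exact Finset.mem_filter.2 ⟨Finset.mem_univ _, hzero⟩
    · intro j _ hj
      rw [ket_of_ne hj.symm, zero_mul]

end BlockEncoding

/-! ### Running time -/

theorem numQubits_le {n : ℕ} (hn : 2 ≤ n) : (numQubits n : ℝ) ≤ 1 + 2 * Real.log n := by
  have h := Nat.pow_pred_clog_lt_self one_lt_two (show 1 < n by omega)
  have hpos : 0 < Nat.clog 2 n := Nat.clog_pos one_lt_two hn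
  have h1 : ((numQubits n - 1 : ℕ) : ℝ) * Real.log 2 ≤ Real.log n := by
    rw [← Real.log_pow]
    refine Real.log_le_log (by positivity) ?_
    exact_mod_cast h.le
  have h2 : ((numQubits n - 1 : ℕ) : ℝ) = numQubits n - 1 := by
    rw [numQubits, Nat.cast_sub (Nat.succ_le_iff.2 hpos), Nat.cast_one]
  have hn0 : (0 : ℝ) ≤ ((numQubits n - 1 : ℕ) : ℝ) := Nat.cast_nonneg _
  nlinarith [Real.log_two_gt_d9]

theorem exists_pow_two_ge {R : ℝ} (hR : 1 ≤ R) :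
    ∃ m : ℕ, 16 * R ≤ 2 ^ m ∧ (m : ℝ) ≤ 5 + 2 * Real.log R := by
  obtain ⟨m, hm, hm'⟩ := exists_nat_pow_near hR one_lt_two
  refine ⟨m + 5, by rw [pow_add, mul_comm]; norm_num; rw [pow_succ] at hm'; linarith, ?_⟩
  have h := Real.log_le_log (by positivity) hm
  rw [Real.log_pow] at h
  push_cast
  have hm0 : (0 : ℝ) ≤ m := Nat.cast_nonneg m
  nlinarith [Real.log_two_gt_d9]

theorem time_le {n s k m : ℕ} {ε : ℝ} (hn : 2 ≤ n) (hs : 1 ≤ s) (hk : 1 ≤ k) (hε : 0 < ε)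
    (hε1 : ε ≤ 1) (hm : (m : ℝ) ≤ 5 + 2 * Real.log (k / ε)) :
    ((k * (3 * numQubits n + 4 * m + 11) : ℕ) : ℝ) ≤
      90 * (k * (Real.log n + Real.log (s * k / ε) ^ (5 / 2 : ℝ))) := by
  have hk' : (1 : ℝ) ≤ k := by exact_mod_cast hk
  have hs' : (1 : ℝ) ≤ s := by exact_mod_cast hs
  have h1 : 1 ≤ k / ε := (one_le_div hε).2 (hε1.trans hk')
  have h2 : k / ε ≤ s * k / ε := by
    rw [mul_div_assoc]
    exact le_mul_of_one_le_left (by positivity) hs'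
  have h3 : Real.log (k / ε) ≤ Real.log (s * k / ε) := Real.log_le_log (by positivity) h2
  set L := Real.log (s * k / ε)
  have hL0 : 0 ≤ L := Real.log_nonneg (h1.trans h2)
  have hL : L ≤ 1 + L ^ (5 / 2 : ℝ) := by
    rcases le_total L 1 with h | h
    · have := Real.rpow_nonneg hL0 (5 / 2)
      linarith
    · have := Real.rpow_le_rpow_of_exponent_le h (show (1 : ℝ) ≤ 5 / 2 by norm_num)
      rw [Real.rpow_one] at this
      linarith
  have hlog : 1 ≤ 2 * Real.log n := by
    have := Real.log_le_log two_pos (show (2 : ℝ) ≤ n by exact_mod_cast hn)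
    linarith [Real.log_two_gt_d9]
  have hw := numQubits_le hn
  have hLr := Real.rpow_nonneg hL0 (5 / 2)
  push_cast
  rw [mul_left_comm]
  refine mul_le_mul_of_nonneg_left ?_ (by positivity)
  linarith

end SparseQuantum

end

theorem mainTheorem4 :
    ∃ C : ℝ, ∀ (n s k b : ℕ) (ε : ℝ), 2 ≤ n → 1 ≤ s → s ≤ n → 1 ≤ k → 0 < ε → ε ≤ 1 →
      ∃ (a : ℕ) (c : SparseQuantum.Circuit (SparseQuantum.numQubits n) b
          (Fin (SparseQuantum.numQubits n) ⊕ Fin a)),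
        (c.time : ℝ) ≤
          C * (k * (Real.log n + Real.log (s * k / ε) ^ (5 / 2 : ℝ))) ∧
        ∀ (A : Matrix (Fin n) (Fin n) ℂ) (O : SparseQuantum.Oracles (SparseQuantum.numQubits n) b),
          SparseQuantum.IsSparse A s → (∀ i j, ‖A i j‖ ≤ 1) →
          SparseQuantum.IsSparseAccess A s (ε / (2 * k)) O →
          SparseQuantum.IsApproxBlockEncoding (c.eval O) (((s : ℂ) ^ k)⁻¹ • A ^ k) ε := by
  refine ⟨90, fun n s k b ε hn hs hsn hk hε hε1 => ?_⟩
  have hk' : (1 : ℝ) ≤ k := by exact_mod_cast hk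
  have hs' : (1 : ℝ) ≤ s := by exact_mod_cast hs
  obtain ⟨m, hm, hmR⟩ := SparseQuantum.exists_pow_two_ge ((one_le_div hε).2 (hε1.trans hk'))
  obtain ⟨B, hB, hstep⟩ := SparseQuantum.exists_encodes_step n s m b hs hsn
  obtain ⟨a, c, hc, hblock⟩ := (hB.pow k).exists_fin
  refine ⟨a, c, (Nat.cast_le.2 hc).trans (SparseQuantum.time_le hn hs hk hε hε1 hmR),
    fun A O hA hA1 hO => ?_⟩
  choose v hv hentry using hO.entry
  -- The matrix that one step encodes, and the matrix that it approximates.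
  set M : Matrix (Fin n) (Fin n) ℂ := Matrix.of fun i j =>
    (s : ℂ)⁻¹ * if A i j = 0 then 0 else SparseQuantum.approxValue m (v i j) with hM
  set N : Matrix (Fin n) (Fin n) ℂ := (s : ℂ)⁻¹ • A with hN
  have hs0 : (0 : ℝ) < (s : ℝ)⁻¹ := by positivity
  have hsnorm : ‖(s : ℂ)⁻¹‖ = (s : ℝ)⁻¹ := by rw [norm_inv, Complex.norm_natCast]
  have hcontr : ∀ x : EuclideanSpace ℂ (Fin n), (s : ℝ) * (s : ℝ)⁻¹ * ‖x‖ = ‖x‖ := fun x => by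
    rw [mul_inv_cancel₀ (by positivity), one_mul]
  have hMx : ∀ j : Fin n, B O *ᵥ SparseQuantum.ket (SparseQuantum.bits _ j) =
      ∑ i, M i j • SparseQuantum.ket (SparseQuantum.bits (SparseQuantum.numQubits n) i) := by
    intro j
    rw [hstep A _ O hA hO v hentry j, Finset.smul_sum]
    simp only [smul_smul, hM, Matrix.of_apply]
  have hM1 : ∀ x : EuclideanSpace ℂ (Fin n),
      ‖(WithLp.toLp 2 (M *ᵥ x.ofLp) : EuclideanSpace ℂ (Fin n))‖ ≤ ‖x‖ := by
    intro x
    refine (SparseQuantum.norm_mulVec_le_of_isSparse hA (fun i j h => ?_) hs0.le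
      (fun i j => ?_) x).trans (hcontr x).le
    · simp [hM, h]
    · rw [hM, Matrix.of_apply, norm_mul, hsnorm]
      refine mul_le_of_le_one_right hs0.le ?_
      split_ifs
      · simp
      · exact SparseQuantum.norm_approxValue_le _ _
  have hN1 : ∀ x : EuclideanSpace ℂ (Fin n),
      ‖(WithLp.toLp 2 (N *ᵥ x.ofLp) : EuclideanSpace ℂ (Fin n))‖ ≤ ‖x‖ := by
    intro x
    refine (SparseQuantum.norm_mulVec_le_of_isSparse hA (fun i j h => ?_) hs0.le
      (fun i j => ?_) x).trans (hcontr x).le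
    · simp [hN, h]
    · rw [hN, Matrix.smul_apply, norm_smul, hsnorm]
      exact mul_le_of_le_one_right hs0.le (hA1 i j)
  have hMN : ∀ x : EuclideanSpace ℂ (Fin n),
      ‖(WithLp.toLp 2 ((M - N) *ᵥ x.ofLp) : EuclideanSpace ℂ (Fin n))‖ ≤ ε / k * ‖x‖ := by
    intro x
    refine (SparseQuantum.norm_mulVec_le_of_isSparse hA (δ := (s : ℝ)⁻¹ * (ε / k))
      (fun i j h => ?_) (by positivity) (fun i j => ?_) x).trans (le_of_eq ?_)
    · simp [hM, hN, h]
    · rw [Matrix.sub_apply, hM, hN, Matrix.of_apply, Matrix.smul_apply, smul_eq_mul, ← mul_sub,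
        norm_mul, hsnorm]
      refine mul_le_mul_of_nonneg_left ?_ hs0.le
      split_ifs with h
      · rw [h, sub_zero, norm_zero]
        positivity
      · refine (SparseQuantum.norm_approxValue_sub_le _ m (hA1 i j)).trans ?_
        have h8 : (8 : ℝ) / 2 ^ m ≤ ε / (2 * k) := by
          rw [div_le_div_iff₀ (by positivity) (by positivity)]
          have := mul_le_mul_of_nonneg_left hm hε.le
          rw [mul_left_comm, mul_div_cancel₀ _ hε.ne'] at this
          linarith
        calc _ ≤ ε / (2 * k) + ε / (2 * k) := add_le_add (hv i j) h8
          _ = ε / k := by field_simp; norm_num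
    · rw [← mul_assoc, mul_inv_cancel₀ (by positivity), one_mul]
  refine SparseQuantum.isApproxBlockEncoding_of_block fun x hx => ?_
  have hNk : ((s : ℂ) ^ k)⁻¹ • A ^ k = N ^ k := by rw [hN, smul_pow, inv_pow]
  rw [hblock, SparseQuantum.pow_mulVec_amplitudes hMx, hNk]
  refine (congrArg norm (SparseQuantum.amplitudes_sub _ _)).trans_le ?_
  rw [SparseQuantum.norm_amplitudes, ← WithLp.toLp_sub]
  refine (SparseQuantum.norm_pow_mulVec_sub_le (by positivity) hM1 hN1 hMN k x).trans
    (le_of_eq ?_)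
  rw [hx, mul_one, mul_div_cancel₀ _ (by positivity)]
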